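/- **Setting.** Let $n$ be odd and let $A=(a_{ij})$ be a real skew-symmetric $n\times n$ matrix (a symmetric zero-sum game). A strategy is a vector $x\ge 0$ in $\mathbb R^n$ with $\sum_i x_i=1$; a strategy $x$ is a Nash equilibrium of $A$ if $x^\top A y\ge 0$ for all strategies $y$. The game $A$ is *non-redundant* if every Nash equilibrium $x$ satisfies $x_i>0$ for all $i$, and *$\alpha$-redundant* if no Nash equilibrium $x$ satisfies $x_i\ge\alpha$ for all $i$. Call $A$ *admissible* if $n\ge 3$ is odd, $A\in[-1,1]^{n\times n}$ is skew-symmetric, $\operatorname{rank}A=n-1$, and $x^\top A=0$ for some $x$ with $\sum_i x_i\neq 0$. For admissible $A$ let $\pi$ be the unique vector with $\pi^\top A=0$ and $\sum_i\pi_i=1$, let $A_j$ be $A$ with its $j$-th column replaced by $\mathbf 1=(1,\dots,1)^\top$ (this is invertible), and let $\varphi(A)=\max_j\max_i|(\mathbf 1^\top A_j^{-1}-\pi^\top)_i|$. In every round the learner, to whom $A$ is unknown, receives one result $X_{ij}$ for every pair $i<j$. All results are independent, and the law of $X_{ij}$ (the same in all rounds) has mean $a_{ij}$ and is 1-sub-Gaussian: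 $\mathbb P[|X_{ij}-a_{ij}|\ge t]\le 2e^{-t^2/2}$ for all $t\ge 0$. A (possibly randomized) sequential algorithm decides after each round, from the results seen so far and its internal randomness, whether to stop, and if so with one of the conclusions "$A$ is non-redundant", "$A$ is $\alpha$-redundant"; $\tau\in\{0,1,2,\dots\}\cup\{\infty\}$ is the number of rounds until it stops. It is *$(\alpha,\delta)$-PAC* if for every admissible $A\in[-1,1]^{n\times n}$ and all such laws it stops with a true conclusion with probability at least $1-\delta$. For $\kappa>0$ and real $s$ let $Q(n,\kappa,s)=(q_{ij})$ be the skew-symmetric $n\times n$ matrix with, for $i<j$, $q_{ij}=\kappa$ if $j-i\le\frac{n-1}2$, $q_{ij}=-\kappa$ if $\frac{n+1}2\le j-i\le n-2$, and $q_{1n}=-2\kappa+s$. **Theorem.** For each $n\in\{5,7,9,\dots,19\}$ there are constants $c,\Phi_0>0$, depending only on $n$, such that for all $0<\alpha\le\frac1{5n}$ and $0<\delta<\frac13$ and every $(\alpha,\delta)$-PAC algorithm the following hold. 1. In the worst case $\mathbb E[\tau]=\Omega(\varphi(A)^2\log\frac1\delta)$: for every $\Phi\ge\Phi_0$ there are an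 admissible $A\in[-1,1]^{n\times n}$ with $\varphi(A)=\Phi$ and laws of the results as above for which $\mathbb E[\tau]\ge c\,\varphi(A)^2\log\frac1\delta$. 2. For every $\kappa$ with $n\alpha\le\kappa$ and $4\kappa+(n-4)\alpha\le 1$ and for each $A\in\{Q(n,\kappa,\alpha),\,Q(n,\kappa,-\alpha)\}$: the game $A$ is admissible, and there are laws of the results as above for which $\mathbb E[\tau]\ge c\,\max\{\frac1{\alpha^2},\varphi(A)^2\}\log\frac1\delta$. -/

import Mathlib

universe u

open MeasureTheory
open scoped ENNReal Matrix

namespace DuelingGame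

/-! ## Symmetric zero-sum games -/

/-- Mixed strategies: probability vectors on `n` moves. -/
def IsStrategy {n : ℕ} (x : Fin n → ℝ) : Prop :=
  (∀ i, 0 ≤ x i) ∧ ∑ i, x i = 1

/-- `x` is a Nash equilibrium of the skew-symmetric game `A`: `xᵀ A y ≥ 0` for all strategies `y`. -/
def IsNash {n : ℕ} (A : Matrix (Fin n) (Fin n) ℝ) (x : Fin n → ℝ) : Prop :=
  IsStrategy x ∧ ∀ y : Fin n → ℝ, IsStrategy y → 0 ≤ x ⬝ᵥ (A *ᵥ y)

/-- `A` is non-redundant (completely mixed): every Nash equilibrium is strictly positive. -/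
def NonRedundant {n : ℕ} (A : Matrix (Fin n) (Fin n) ℝ) : Prop :=
  ∀ x : Fin n → ℝ, IsNash A x → ∀ i, 0 < x i

/-- `A` is `α`-redundant: no Nash equilibrium has all of its probabilities at least `α`. -/
def AlphaRedundant {n : ℕ} (α : ℝ) (A : Matrix (Fin n) (Fin n) ℝ) : Prop :=
  ¬ ∃ x : Fin n → ℝ, IsNash A x ∧ ∀ i, α ≤ x i

/-- The standing condition on the unknown pay-off matrix. -/
structure IsAdmissible {n : ℕ} (A : Matrix (Fin n) (Fin n) ℝ) : Prop where
  odd : Odd n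
  three_le : 3 ≤ n
  bounded : ∀ i j, A i j ∈ Set.Icc (-1 : ℝ) 1
  skew : Aᵀ = -A
  rank_eq : A.rank = n - 1
  exists_kernel : ∃ x : Fin n → ℝ, x ᵥ* A = 0 ∧ ∑ i, x i ≠ 0

open Classical in
/-- The vector `π` with `πᵀ A = 0` and `∑ π i = 1`; it exists and is unique if `A` is admissible
(its entries need not be nonnegative). -/
noncomputable def kernelVec {n : ℕ} (A : Matrix (Fin n) (Fin n) ℝ) : Fin n → ℝ :=
  if h : ∃ x : Fin n → ℝ, x ᵥ* A = 0 ∧ ∑ i, x i = 1 then h.choose else 0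

/-- `A_j`: the `j`-th column of `A` is replaced by the all-one column. -/
def colOne {n : ℕ} (A : Matrix (Fin n) (Fin n) ℝ) (j : Fin n) : Matrix (Fin n) (Fin n) ℝ :=
  A.updateCol j 1

/-- `φ(A) = max_j max_i |(1ᵀ A_j⁻¹ - πᵀ)_i|`. For an admissible `A` all the `A_j` are
invertible. -/
noncomputable def phi {n : ℕ} (A : Matrix (Fin n) (Fin n) ℝ) : ℝ :=
  ⨆ j : Fin n, ⨆ i : Fin n, |((1 : Fin n → ℝ) ᵥ* (colOne A j)⁻¹) i - kernelVec A i|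

/-! ## Duels -/

/-- The unordered pairs of distinct moves, each represented as `(i, j)` with `i < j`. -/
abbrev Pair (n : ℕ) : Type := {p : Fin n × Fin n // p.1 < p.2}

/-- The results of one round, in which every pair duels once. -/
abbrev Round (n : ℕ) : Type := Pair n → ℝ

/-- `ν` is a probability law with mean `a` that is 1-sub-Gaussian. -/
structure IsSubGaussianWithMean (ν : Measure ℝ) (a : ℝ) : Prop where
  prob : IsProbabilityMeasure ν
  integrable : Integrable (fun x : ℝ => x) ν
  mean : ∫ x, x ∂ν = a
  tail : ∀ c : ℝ, 0 ≤ c → ν {x | c ≤ |x - a|} ≤ ENNReal.ofReal (2 * Real.exp (-(c ^ 2) / 2))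

/-- A feedback model for the game `A`: for every pair `i < j` the law of the result `X_ij`. -/
def IsFeedback {n : ℕ} (A : Matrix (Fin n) (Fin n) ℝ) (ν : Pair n → Measure ℝ) : Prop :=
  ∀ p : Pair n, IsSubGaussianWithMean (ν p) (A p.1.1 p.1.2)

/-- The two possible conclusions of the learner. -/
inductive Verdict : Type
  | nonRedundant
  | alphaRedundant

/-- The conclusion `v` is a true statement about `A`. -/
def Verdict.Correct {n : ℕ} (α : ℝ) (A : Matrix (Fin n) (Fin n) ℝ) : Verdict → Prop
  | .nonRedundant => NonRedundant A
  | .alphaRedundant => AlphaRedundant α A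

/-- A (possibly randomized) sequential algorithm. After `t` rounds it sees its internal random
seed and the results of these `t` rounds; it then either stops with a verdict (`some v`) or asks
for another round (`none`). -/
structure Algorithm (n : ℕ) where
  Seed : Type u
  [seedSpace : MeasurableSpace Seed]
  seedLaw : Measure Seed
  [seedProb : IsProbabilityMeasure seedLaw]
  rule : (t : ℕ) → Seed → (Fin t → Round n) → Option Verdict
  measurable_rule : ∀ (t : ℕ) (v : Verdict),
    MeasurableSet {x : Seed × (Fin t → Round n) | rule t x.1 x.2 = some v}

attribute [instance] Algorithm.seedSpace Algorithm.seedProb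

namespace Algorithm

variable {n : ℕ}

/-- What the algorithm would do after `t` rounds on the sample point `x`, which consists of the
seed and the infinite sequence of the results of all rounds. -/
def act (𝒜 : Algorithm.{u} n) (x : 𝒜.Seed × (ℕ → Round n)) (t : ℕ) : Option Verdict :=
  𝒜.rule t x.1 (fun s : Fin t => x.2 s)

/-- The number `τ` of rounds until the algorithm stops (`∞` if it never does). -/
noncomputable def stopTime (𝒜 : Algorithm.{u} n) (x : 𝒜.Seed × (ℕ → Round n)) : ℝ≥0∞ :=
  ⨅ (t : ℕ) (_ : 𝒜.act x t ≠ none), (t : ℝ≥0∞)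

/-- On the sample point `x` the algorithm stops and concludes `v`. -/
def Concludes (𝒜 : Algorithm.{u} n) (x : 𝒜.Seed × (ℕ → Round n)) (v : Verdict) : Prop :=
  ∃ t : ℕ, 𝒜.act x t = some v ∧ ∀ s < t, 𝒜.act x s = none

/-- The joint law of the seed and of all results: the results of all pairs in all rounds are
independent, independent of the seed, and a result of the pair `p` has law `ν p`. -/
noncomputable def law (𝒜 : Algorithm.{u} n) (ν : Pair n → Measure ℝ) :
    Measure (𝒜.Seed × (ℕ → Round n)) :=
  𝒜.seedLaw.prod (Measure.infinitePi fun _ : ℕ => Measure.pi ν)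

/-- The expected running time `E[τ]` under the feedback model `ν`. -/
noncomputable def expectedTime (𝒜 : Algorithm.{u} n) (ν : Pair n → Measure ℝ) : ℝ≥0∞ :=
  ∫⁻ x, 𝒜.stopTime x ∂(𝒜.law ν)

/-- `(α, δ)`-PAC: for every admissible game and every sub-Gaussian feedback model for it, the
algorithm stops with a true conclusion with probability at least `1 - δ`. -/
def IsPAC (𝒜 : Algorithm.{u} n) (α δ : ℝ) : Prop :=
  ∀ A : Matrix (Fin n) (Fin n) ℝ, IsAdmissible A → ∀ ν : Pair n → Measure ℝ, IsFeedback A ν →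
    ENNReal.ofReal (1 - δ) ≤ 𝒜.law ν {x | ∃ v : Verdict, 𝒜.Concludes x v ∧ v.Correct α A}

/-- There is a feedback model for the game `A` under which the expected running time is at
least `b`. -/
def NeedsRounds (𝒜 : Algorithm.{u} n) (A : Matrix (Fin n) (Fin n) ℝ) (b : ℝ) : Prop :=
  ∃ ν : Pair n → Measure ℝ, IsFeedback A ν ∧ ENNReal.ofReal b ≤ 𝒜.expectedTime ν

end Algorithm

/-! ## The family of hard games -/

/-- The entry of `Q(n, κ, s)` at distance `d = j - i > 0` above the diagonal. -/
noncomputable def hardEntry (n : ℕ) (κ s : ℝ) (d : ℕ) : ℝ :=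
  if d ≤ (n - 1) / 2 then κ else if d ≤ n - 2 then -κ else -2 * κ + s

/-- The skew-symmetric matrix `Q(n, κ, s)`. -/
noncomputable def hardGame (n : ℕ) (κ s : ℝ) : Matrix (Fin n) (Fin n) ℝ := fun i j =>
  if i < j then hardEntry n κ s (j.val - i.val)
  else if j < i then -hardEntry n κ s (i.val - j.val)
  else 0

end DuelingGame

/-! Put `s = κ r`. The matrix `Q(n, κ, κ r)` has a one-dimensional kernel, spanned by `(1, r, …, r,
2 - r, r, …, r, 1)`. For small `r > 0` the normalised kernel vector is an equilibrium whose smallest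
weight is `r / (4 + (n - 4) r)`, so under the condition `α (4 + (n - 4) r) ≤ r` the game is not
`α`-redundant. For `r < 0` the kernel vector has entries of both signs. A completely mixed
equilibrium would lie in the kernel, and some equilibrium exists by the minimax theorem, so the game
is not non-redundant. Hence the games for `r` and `-r` share no true verdict, although they differ
only in the duel of the first and last moves, by `2 κ |r|` (`verdict_hardGame`,
`sum_sq_sub_hardGame`).

With two-point laws, telling the two games apart takes on the order of `(κ r)⁻² log (1/δ)` rounds.
The change of measure is a Cauchy–Schwarz (chi-square) inequality that tensorizes over pairs and
rounds: an event decided by round `T` satisfies `P(E)² ≤ exp (2 D T) P'(E)`, where `D` bounds the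
squared distance of the games. Take for `E` the event of stopping by time `T` with a verdict true
for the first game; Markov's inequality and the PAC property make `P(E)` bounded below and `P'(E) ≤
δ` (`Algorithm.IsPAC.needsRounds`).

The bound is compared with `φ` in two ways. Exact scaling, `φ(Q(n, κ, κ r)) = φ(Q(n, 1, r)) / κ`,
gives the first claim with `r` fixed and `κ` tuned to `Φ`. The estimate `φ(Q(n, κ, κ r)) ≤ C / (κ
|r|)` gives the second claim with `r = ± α / κ`; it rests on a coercivity bound uniform in the
perturbation, reduced to the circulant game `Q(n, 1, 1)`. -/

namespace DuelingGame

/-! ## Second-moment domination of measures -/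

/-- The second-moment (chi-square) comparison of two measures: `(∫ f dμ)² ≤ K ∫ f² dμ'`. -/
def SecondMomentDom {X : Type*} [MeasurableSpace X] (μ μ' : Measure X) (K : ℝ≥0∞) : Prop :=
  ∀ f : X → ℝ≥0∞, Measurable f → (∫⁻ x, f x ∂μ) ^ 2 ≤ K * ∫⁻ x, f x ^ 2 ∂μ'

namespace SecondMomentDom

variable {X Y : Type*} [MeasurableSpace X] [MeasurableSpace Y]

/-- Cauchy–Schwarz against the constant 1. It handles the seed, whose law does not depend on the
game. -/
theorem refl (μ : Measure X) [IsProbabilityMeasure μ] : SecondMomentDom μ μ 1 := by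
  intro f hf
  have h := ENNReal.lintegral_mul_le_Lp_mul_Lq μ Real.HolderConjugate.two_two hf.aemeasurable
    (g := fun _ => 1) aemeasurable_const
  simp only [Pi.mul_apply, mul_one, ENNReal.rpow_two, one_pow, lintegral_const, measure_univ,
    ENNReal.one_rpow] at h
  calc (∫⁻ x, f x ∂μ) ^ 2 ≤ ((∫⁻ x, f x ^ 2 ∂μ) ^ (1 / 2 : ℝ)) ^ 2 := by gcongr
    _ = 1 * ∫⁻ x, f x ^ 2 ∂μ := by
      rw [← ENNReal.rpow_two, ← ENNReal.rpow_mul]; norm_num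

theorem map {μ μ' : Measure X} {K : ℝ≥0∞} (h : SecondMomentDom μ μ' K) {g : X → Y}
    (hg : Measurable g) : SecondMomentDom (μ.map g) (μ'.map g) K := by
  intro f hf
  rw [lintegral_map hf hg, lintegral_map (hf.pow_const 2) hg]
  exact h _ (hf.comp hg)

/-- Apply the first comparison to the inner integral over `ν`, then the second one pointwise under
the outer integral. -/
theorem prod {μ μ' : Measure X} {ν ν' : Measure Y} [SFinite ν] [SFinite ν'] {K L : ℝ≥0∞}
    (hμ : SecondMomentDom μ μ' K) (hν : SecondMomentDom ν ν' L) :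
    SecondMomentDom (μ.prod ν) (μ'.prod ν') (K * L) := by
  intro f hf
  rw [lintegral_prod _ hf.aemeasurable, lintegral_prod _ (hf.pow_const 2).aemeasurable]
  calc (∫⁻ x, ∫⁻ y, f (x, y) ∂ν ∂μ) ^ 2
      ≤ K * ∫⁻ x, (∫⁻ y, f (x, y) ∂ν) ^ 2 ∂μ' := hμ _ hf.lintegral_prod_right'
    _ ≤ K * ∫⁻ x, L * ∫⁻ y, f (x, y) ^ 2 ∂ν' ∂μ' := by
        gcongr with x
        exact hν _ (hf.comp measurable_prodMk_left)
    _ = K * L * ∫⁻ x, ∫⁻ y, f (x, y) ^ 2 ∂ν' ∂μ' := by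
        rw [lintegral_const_mul _ (hf.pow_const 2).lintegral_prod_right', mul_assoc]

theorem pi_fin {n : ℕ} {μ μ' : Fin n → Measure X} [∀ i, IsProbabilityMeasure (μ i)]
    [∀ i, IsProbabilityMeasure (μ' i)] {K : Fin n → ℝ≥0∞}
    (h : ∀ i, SecondMomentDom (μ i) (μ' i) (K i)) :
    SecondMomentDom (Measure.pi μ) (Measure.pi μ') (∏ i, K i) := by
  induction n with
  | zero =>
    have : Measure.pi μ = Measure.pi μ' := by congr 1; ext i; exact i.elim0
    rw [this]
    simpa using refl (Measure.pi μ')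
  | succ n ih =>
    have e := (measurePreserving_piFinSuccAbove (α := fun _ => X) μ 0).symm.map_eq
    have e' := (measurePreserving_piFinSuccAbove (α := fun _ => X) μ' 0).symm.map_eq
    rw [← e, ← e', Fin.prod_univ_succ]
    refine map (prod (h 0) ?_) (MeasurableEquiv.measurable _)
    exact ih fun i => h i.succ

theorem pi {ι : Type*} [Fintype ι] {μ μ' : ι → Measure X} [∀ i, IsProbabilityMeasure (μ i)]
    [∀ i, IsProbabilityMeasure (μ' i)] {K : ι → ℝ≥0∞}
    (h : ∀ i, SecondMomentDom (μ i) (μ' i) (K i)) :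
    SecondMomentDom (Measure.pi μ) (Measure.pi μ') (∏ i, K i) := by
  let e := (Fintype.equivFin ι).symm
  rw [← (measurePreserving_piCongrLeft (α := fun _ => X) μ e).map_eq,
    ← (measurePreserving_piCongrLeft (α := fun _ => X) μ' e).map_eq, ← e.prod_comp]
  exact map (pi_fin fun i => h (e i)) (MeasurableEquiv.measurable _)

theorem measure_sq_le {μ μ' : Measure X} {K : ℝ≥0∞} (h : SecondMomentDom μ μ' K) {s : Set X}
    (hs : MeasurableSet s) : μ s ^ 2 ≤ K * μ' s := by
  have h1 := h (s.indicator 1) (measurable_one.indicator hs)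
  have h2 : (fun x => (s.indicator (1 : X → ℝ≥0∞) x) ^ 2) = s.indicator 1 := by
    ext x; by_cases hx : x ∈ s <;> simp [hx]
  rwa [h2, lintegral_indicator_one hs, lintegral_indicator_one hs] at h1

end SecondMomentDom

/-! ## Two-point laws -/

/-- The law on `{1, -1}` with mean `a`. -/
noncomputable def rademacher (a : ℝ) : Measure ℝ :=
  ENNReal.ofReal ((1 + a) / 2) • Measure.dirac 1 + ENNReal.ofReal ((1 - a) / 2) • Measure.dirac (-1)

theorem lintegral_rademacher (a : ℝ) {f : ℝ → ℝ≥0∞} :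
    ∫⁻ x, f x ∂rademacher a
      = ENNReal.ofReal ((1 + a) / 2) * f 1 + ENNReal.ofReal ((1 - a) / 2) * f (-1) := by
  simp [rademacher, lintegral_add_measure]

theorem isProbabilityMeasure_rademacher {a : ℝ} (ha : |a| ≤ 1) :
    IsProbabilityMeasure (rademacher a) := by
  rw [abs_le] at ha
  constructor
  simp only [rademacher, Measure.coe_add, Measure.coe_smul, Pi.add_apply, Pi.smul_apply,
    measure_univ, smul_eq_mul, mul_one]
  rw [← ENNReal.ofReal_add (by linarith) (by linarith), ← ENNReal.ofReal_one]
  congr 1; ring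

/-- The atoms lie at distances `1 - a` and `1 + a` from `a`, so at most one is farther away than 1,
and it is the lighter one. -/
theorem rademacher_le_half {a : ℝ} (ha : |a| ≤ 1) {c : ℝ} (hc : 1 < c) :
    rademacher a {x | c ≤ |x - a|} ≤ ENNReal.ofReal (1 / 2) := by
  have ha' := abs_le.1 ha
  simp only [rademacher, Measure.coe_add, Measure.coe_smul, Pi.add_apply, Pi.smul_apply,
    smul_eq_mul, Measure.dirac_apply, Set.indicator_apply, Set.mem_ofPred_eq, Pi.one_apply,
    abs_of_nonneg (show 0 ≤ 1 - a by linarith),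
    abs_of_nonpos (show -1 - a ≤ 0 by linarith)]
  split_ifs with h1 h2 h2
  · linarith
  · simp only [mul_one, mul_zero, add_zero]
    exact ENNReal.ofReal_le_ofReal (by linarith)
  · simp only [mul_one, mul_zero, zero_add]
    exact ENNReal.ofReal_le_ofReal (by linarith)
  · simp

theorem rademacher_eq_zero {a : ℝ} (ha : |a| ≤ 3 / 5) {c : ℝ} (hc : 8 / 5 < c) :
    rademacher a {x | c ≤ |x - a|} = 0 := by
  have ha' := abs_le.1 ha
  simp only [rademacher, Measure.coe_add, Measure.coe_smul, Pi.add_apply, Pi.smul_apply,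
    smul_eq_mul, Measure.dirac_apply, Set.indicator_apply, Set.mem_ofPred_eq, Pi.one_apply,
    abs_of_nonneg (show 0 ≤ 1 - a by linarith),
    abs_of_nonpos (show -1 - a ≤ 0 by linarith)]
  rw [if_neg (by linarith), if_neg (by linarith)]
  simp

/-- Three ranges of `c`. Up to 1 the tail bound exceeds 1, since `1/2 < log 2`. Up to `8/5` it
exceeds `1/2`, since `(8/5)²/2 < 2 log 2`. Beyond `8/5 = 1 + 3/5` there is no mass left; this is
where `|a| ≤ 3/5` enters. -/
theorem isSubGaussianWithMean_rademacher {a : ℝ} (ha : |a| ≤ 3 / 5) :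
    IsSubGaussianWithMean (rademacher a) a := by
  have ha1 : |a| ≤ 1 := by linarith
  have ha' := abs_le.1 ha1
  have := isProbabilityMeasure_rademacher ha1
  have i1 : Integrable (fun x : ℝ => x) (ENNReal.ofReal ((1 + a) / 2) • Measure.dirac (1 : ℝ)) :=
    (integrable_dirac (by simp)).smul_measure ENNReal.ofReal_ne_top
  have i2 : Integrable (fun x : ℝ => x)
      (ENNReal.ofReal ((1 - a) / 2) • Measure.dirac (-1 : ℝ)) :=
    (integrable_dirac (by simp)).smul_measure ENNReal.ofReal_ne_top
  refine ⟨this, i1.add_measure i2, ?_, fun c hc => ?_⟩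
  · rw [rademacher, integral_add_measure i1 i2, integral_smul_measure, integral_smul_measure,
      integral_dirac, integral_dirac, ENNReal.toReal_ofReal (by linarith),
      ENNReal.toReal_ofReal (by linarith)]
    simp only [smul_eq_mul]; ring
  · have exp_le : ∀ u : ℝ, u ≤ 2 * Real.log 2 → 1 / 4 ≤ Real.exp (-u) := fun u hu => by
      have : Real.exp (-(2 * Real.log 2)) = 1 / 4 := by
        rw [Real.exp_neg, two_mul, Real.exp_add, Real.exp_log (by norm_num)]; norm_num
      rw [← this]; exact Real.exp_le_exp.2 (by linarith)
    have hlog := Real.log_two_gt_d9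
    rcases le_or_gt c 1 with h | h
    · refine prob_le_one.trans ?_
      rw [← ENNReal.ofReal_one]
      refine ENNReal.ofReal_le_ofReal ?_
      have : Real.exp (-Real.log 2) = 1 / 2 := by
        rw [Real.exp_neg, Real.exp_log (by norm_num)]; norm_num
      have h2 : Real.exp (-Real.log 2) ≤ Real.exp (-(c ^ 2) / 2) :=
        Real.exp_le_exp.2 (by nlinarith)
      linarith
    · rcases le_or_gt c (8 / 5) with h' | h'
      · refine (rademacher_le_half ha1 h).trans (ENNReal.ofReal_le_ofReal ?_)
        have := exp_le (c ^ 2 / 2) (by nlinarith)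
        rw [neg_div]
        linarith
      · rw [rademacher_eq_zero ha h']
        exact zero_le

/-- The optimal constant is one plus the chi-square divergence, `1 + (a - b)² / (1 - b²)`. As `1 -
b² ≥ 16/25`, it is at most `1 + 2 (a - b)²`. -/
theorem secondMomentDom_rademacher {a b : ℝ} (ha : |a| ≤ 1) (hb : |b| ≤ 3 / 5) :
    SecondMomentDom (rademacher a) (rademacher b) (ENNReal.ofReal (Real.exp (2 * (a - b) ^ 2))) := by
  intro f _
  have ha' := abs_le.1 ha
  have hb' := abs_le.1 hb
  rw [lintegral_rademacher, lintegral_rademacher]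
  have hK : 0 < Real.exp (2 * (a - b) ^ 2) := Real.exp_pos _
  have hp : ENNReal.ofReal ((1 + b) / 2) ≠ 0 := by
    rw [Ne, ENNReal.ofReal_eq_zero, not_le]; linarith
  have hq : ENNReal.ofReal ((1 - b) / 2) ≠ 0 := by
    rw [Ne, ENNReal.ofReal_eq_zero, not_le]; linarith
  have hK' : ENNReal.ofReal (Real.exp (2 * (a - b) ^ 2)) ≠ 0 := by
    rw [Ne, ENNReal.ofReal_eq_zero, not_le]; exact hK
  -- Both atoms have positive mass under `rademacher b`, so an infinite value of `f` makes the right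
  -- side infinite.
  by_cases h1 : f 1 = ⊤
  · simp [h1, ENNReal.mul_top, hp, hK']
  by_cases h2 : f (-1) = ⊤
  · simp [h2, ENNReal.mul_top, hq, hK']
  obtain ⟨x, hx0, hx⟩ : ∃ x : ℝ, 0 ≤ x ∧ f 1 = ENNReal.ofReal x :=
    ⟨(f 1).toReal, ENNReal.toReal_nonneg, (ENNReal.ofReal_toReal h1).symm⟩
  obtain ⟨y, hy0, hy⟩ : ∃ y : ℝ, 0 ≤ y ∧ f (-1) = ENNReal.ofReal y :=
    ⟨(f (-1)).toReal, ENNReal.toReal_nonneg, (ENNReal.ofReal_toReal h2).symm⟩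
  have p1 : 0 ≤ (1 + a) / 2 := by linarith
  have p2 : 0 ≤ (1 - a) / 2 := by linarith
  have p3 : 0 ≤ (1 + b) / 2 := by linarith
  have p4 : 0 ≤ (1 - b) / 2 := by linarith
  rw [hx, hy, ← ENNReal.ofReal_pow hx0, ← ENNReal.ofReal_pow hy0, ← ENNReal.ofReal_mul p1,
    ← ENNReal.ofReal_mul p2, ← ENNReal.ofReal_mul p3, ← ENNReal.ofReal_mul p4,
    ← ENNReal.ofReal_add (by positivity) (by positivity),
    ← ENNReal.ofReal_add (by positivity) (by positivity), ← ENNReal.ofReal_pow (by positivity),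
    ← ENNReal.ofReal_mul hK.le]
  refine ENNReal.ofReal_le_ofReal ?_
  have hexp : 1 + 2 * (a - b) ^ 2 ≤ Real.exp (2 * (a - b) ^ 2) := by
    linarith [Real.add_one_le_exp (2 * (a - b) ^ 2)]
  refine le_trans ?_ (mul_le_mul_of_nonneg_right hexp (by positivity))
  have hb2 : 0 < 1 - b ^ 2 := by nlinarith
  -- Lagrange's identity: the difference of the two sides is a quarter of the first square supplied.
  have key : ((1 + a) / 2 * x + (1 - a) / 2 * y) ^ 2 * (1 - b ^ 2)
      ≤ (1 - b ^ 2 + (a - b) ^ 2) * ((1 + b) / 2 * x ^ 2 + (1 - b) / 2 * y ^ 2) := by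
    nlinarith [sq_nonneg ((1 + a) * (1 - b) * y - (1 - a) * (1 + b) * x), sq_nonneg (x - y)]
  have hbb : 1 ≤ 2 * (1 - b ^ 2) := by nlinarith
  have hW : 0 ≤ (1 + b) / 2 * x ^ 2 + (1 - b) / 2 * y ^ 2 := by positivity
  refine le_of_mul_le_mul_right (key.trans ?_) hb2
  have : 1 - b ^ 2 + (a - b) ^ 2 ≤ (1 + 2 * (a - b) ^ 2) * (1 - b ^ 2) := by
    nlinarith [mul_le_mul_of_nonneg_right hbb (sq_nonneg (a - b))]
  calc _ ≤ (1 + 2 * (a - b) ^ 2) * (1 - b ^ 2) * ((1 + b) / 2 * x ^ 2 + (1 - b) / 2 * y ^ 2) :=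
        mul_le_mul_of_nonneg_right this hW
    _ = _ := by ring

/-! ## Change of measure for sequential algorithms -/

namespace Algorithm

variable {n : ℕ}

/-- The decision after `t` rounds, computed from the results of the first `T` rounds only. -/
def actTrunc (𝒜 : Algorithm.{u} n) (T : ℕ) (y : 𝒜.Seed × (Finset.range T → Round n)) (t : ℕ) :
    Option Verdict :=
  𝒜.rule t y.1 (fun s : Fin t => if h : (s : ℕ) ∈ Finset.range T then y.2 ⟨s, h⟩ else 0)

/-- The padding by 0 in `actTrunc` is never read at times `t ≤ T`. -/
theorem actTrunc_restrict (𝒜 : Algorithm.{u} n) {T t : ℕ} (ht : t ≤ T)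
    (x : 𝒜.Seed × (ℕ → Round n)) :
    𝒜.actTrunc T (Prod.map id (Finset.range T).restrict x) t = 𝒜.act x t := by
  unfold actTrunc act
  congr 1
  funext s
  have : (s : ℕ) ∈ Finset.range T := Finset.mem_range.2 (s.2.trans_le ht)
  simp [this]

theorem measurableSet_actTrunc_eq_some (𝒜 : Algorithm.{u} n) (T t : ℕ) (v : Verdict) :
    MeasurableSet {y | 𝒜.actTrunc T y t = some v} := by
  have hg : Measurable fun y : 𝒜.Seed × (Finset.range T → Round n) =>
      (y.1, fun s : Fin t => if h : (s : ℕ) ∈ Finset.range T then y.2 ⟨s, h⟩ else 0) := by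
    refine measurable_fst.prodMk (measurable_pi_lambda _ fun s => ?_)
    split_ifs with h
    · exact (measurable_pi_apply _).comp measurable_snd
    · exact measurable_const
  exact hg (𝒜.measurable_rule t v)

theorem measurableSet_actTrunc_eq_none (𝒜 : Algorithm.{u} n) (T t : ℕ) :
    MeasurableSet {y | 𝒜.actTrunc T y t = none} := by
  have : {y | 𝒜.actTrunc T y t = none} = ({y | 𝒜.actTrunc T y t = some .nonRedundant} ∪
      {y | 𝒜.actTrunc T y t = some .alphaRedundant})ᶜ := by
    ext y
    simp only [Set.mem_ofPred_eq, Set.mem_compl_iff, Set.mem_union]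
    rcases h : 𝒜.actTrunc T y t with _ | _ | _ <;> simp
  rw [this]
  exact ((𝒜.measurableSet_actTrunc_eq_some T t _).union
    (𝒜.measurableSet_actTrunc_eq_some T t _)).compl

/-- The algorithm stops after at most `T` rounds, with a conclusion in `V`. -/
def concludesBy (𝒜 : Algorithm.{u} n) (T : ℕ) (V : Set Verdict) :
    Set (𝒜.Seed × (ℕ → Round n)) :=
  {x | ∃ t ≤ T, (∃ v ∈ V, 𝒜.act x t = some v) ∧ ∀ s < t, 𝒜.act x s = none}

/-- The algorithm has not stopped after `T` rounds. -/
def runsPast (𝒜 : Algorithm.{u} n) (T : ℕ) : Set (𝒜.Seed × (ℕ → Round n)) :=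
  {x | ∀ s ≤ T, 𝒜.act x s = none}

/-- The event depends only on the seed and the first `T` rounds, so finite products of measures
suffice for its probability. -/
theorem exists_concludesBy_eq_preimage (𝒜 : Algorithm.{u} n) (T : ℕ) (V : Set Verdict) :
    ∃ S, MeasurableSet S ∧
      𝒜.concludesBy T V = Prod.map id (Finset.range T).restrict ⁻¹' S := by
  refine ⟨⋃ t ∈ Set.Iic T, (⋃ v ∈ V, {y | 𝒜.actTrunc T y t = some v}) ∩
    ⋂ s ∈ Set.Iio t, {y | 𝒜.actTrunc T y s = none}, ?_, ?_⟩
  · refine MeasurableSet.biUnion (Set.to_countable _) fun t _ => MeasurableSet.inter ?_ ?_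
    · have hV : V.Countable :=
        ((Set.toFinite {.nonRedundant, .alphaRedundant}).subset
          fun v _ => by cases v <;> simp).countable
      exact MeasurableSet.biUnion hV fun v _ => 𝒜.measurableSet_actTrunc_eq_some T t v
    · exact MeasurableSet.biInter (Set.to_countable _) fun s _ =>
        𝒜.measurableSet_actTrunc_eq_none T s
  · ext x
    simp only [concludesBy, Set.mem_preimage, Set.mem_iUnion, Set.mem_inter_iff, Set.mem_iInter,
      Set.mem_Iic, Set.mem_Iio, Set.mem_ofPred_eq, exists_prop]
    refine exists_congr fun t => and_congr_right fun ht => and_congr ?_ ?_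
    · rw [𝒜.actTrunc_restrict ht]
    · refine forall₂_congr fun s hs => ?_
      rw [𝒜.actTrunc_restrict (hs.le.trans ht)]

theorem measurable_map_restrict (𝒜 : Algorithm.{u} n) (T : ℕ) :
    Measurable (Prod.map (id : 𝒜.Seed → 𝒜.Seed)
      ((Finset.range T).restrict (π := fun _ => Round n))) :=
  measurable_id.prodMap (Finset.measurable_restrict _)

theorem measurableSet_concludesBy (𝒜 : Algorithm.{u} n) (T : ℕ) (V : Set Verdict) :
    MeasurableSet (𝒜.concludesBy T V) := by
  obtain ⟨S, hS, h⟩ := 𝒜.exists_concludesBy_eq_preimage T V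
  rw [h]
  exact 𝒜.measurable_map_restrict T hS

theorem measurableSet_runsPast (𝒜 : Algorithm.{u} n) (T : ℕ) :
    MeasurableSet (𝒜.runsPast T) := by
  have : 𝒜.runsPast T = Prod.map id (Finset.range T).restrict ⁻¹'
      ⋂ s ∈ Set.Iic T, {y | 𝒜.actTrunc T y s = none} := by
    ext x
    simp only [runsPast, Set.mem_preimage, Set.mem_iInter, Set.mem_Iic, Set.mem_ofPred_eq]
    refine forall₂_congr fun s hs => ?_
    rw [𝒜.actTrunc_restrict hs]
  rw [this]
  exact 𝒜.measurable_map_restrict T (MeasurableSet.biInter (Set.to_countable _) fun s _ =>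
    𝒜.measurableSet_actTrunc_eq_none T s)

instance (𝒜 : Algorithm.{u} n) (ν : Pair n → Measure ℝ) [∀ p, IsProbabilityMeasure (ν p)] :
    IsProbabilityMeasure (𝒜.law ν) := by
  unfold law; infer_instance

theorem map_restrict_law (𝒜 : Algorithm.{u} n) (ν : Pair n → Measure ℝ)
    [∀ p, IsProbabilityMeasure (ν p)] (T : ℕ) :
    (𝒜.law ν).map (Prod.map id (Finset.range T).restrict)
      = 𝒜.seedLaw.prod (Measure.pi fun _ : Finset.range T => Measure.pi ν) := by
  rw [law, ← Measure.map_prod_map _ _ measurable_id (Finset.measurable_restrict _),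
    Measure.map_id, Measure.infinitePi_map_restrict]

theorem law_concludesBy_sq_le (𝒜 : Algorithm.{u} n) {ν ν' : Pair n → Measure ℝ}
    [∀ p, IsProbabilityMeasure (ν p)] [∀ p, IsProbabilityMeasure (ν' p)] {K : ℝ≥0∞}
    (h : SecondMomentDom (Measure.pi ν) (Measure.pi ν') K) (T : ℕ) (V : Set Verdict) :
    𝒜.law ν (𝒜.concludesBy T V) ^ 2 ≤ K ^ T * 𝒜.law ν' (𝒜.concludesBy T V) := by
  obtain ⟨S, hS, hSeq⟩ := 𝒜.exists_concludesBy_eq_preimage T V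
  have hm := 𝒜.measurable_map_restrict T
  rw [hSeq, ← Measure.map_apply hm hS, ← Measure.map_apply hm hS, map_restrict_law,
    map_restrict_law]
  have hdom := (SecondMomentDom.refl 𝒜.seedLaw).prod
    (SecondMomentDom.pi (ι := Finset.range T) fun _ => h)
  simpa using hdom.measure_sq_le hS

/-- Markov's inequality: not having stopped at any of the times `0, …, T` means `τ ≥ T + 1`. -/
theorem mul_law_runsPast_le_expectedTime (𝒜 : Algorithm.{u} n) (ν : Pair n → Measure ℝ) (T : ℕ) :
    ((T + 1 : ℕ) : ℝ≥0∞) * 𝒜.law ν (𝒜.runsPast T) ≤ 𝒜.expectedTime ν := by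
  rw [← lintegral_indicator_const (𝒜.measurableSet_runsPast T)]
  refine lintegral_mono fun x => ?_
  by_cases hx : x ∈ 𝒜.runsPast T
  · rw [Set.indicator_of_mem hx]
    refine le_iInf₂ fun t ht => ?_
    have : T + 1 ≤ t := by
      by_contra hlt
      exact ht (hx t (by omega))
    exact_mod_cast this
  · rw [Set.indicator_of_notMem hx]
    exact zero_le

theorem Concludes.unique {𝒜 : Algorithm.{u} n} {x : 𝒜.Seed × (ℕ → Round n)} {v w : Verdict}
    (hv : 𝒜.Concludes x v) (hw : 𝒜.Concludes x w) : v = w := by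
  obtain ⟨t, ht, ht'⟩ := hv
  obtain ⟨s, hs, hs'⟩ := hw
  rcases lt_trichotomy t s with h | h | h
  · simp [hs' t h] at ht
  · subst h; simpa [ht] using hs
  · simp [ht' s h] at hs

/-- Two games without a common true verdict force a PAC algorithm to run for a time inversely
proportional to the squared distance of the games. -/
theorem IsPAC.needsRounds {𝒜 : Algorithm.{u} n} {α δ : ℝ} (h𝒜 : 𝒜.IsPAC α δ) (hδ0 : 0 < δ)
    (hδ : δ < 1 / 3) {A A' : Matrix (Fin n) (Fin n) ℝ} (hA : IsAdmissible A)
    (hA' : IsAdmissible A') (hv : ∀ v : Verdict, v.Correct α A → ¬ v.Correct α A')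
    (hAb : ∀ p : Pair n, |A p.1.1 p.1.2| ≤ 3 / 5)
    (hAb' : ∀ p : Pair n, |A' p.1.1 p.1.2| ≤ 3 / 5) {D : ℝ} (hD0 : 0 < D)
    (hD : ∑ p : Pair n, (A p.1.1 p.1.2 - A' p.1.1 p.1.2) ^ 2 ≤ D) :
    𝒜.NeedsRounds A (1 / (800 * D) * Real.log (1 / δ)) := by
  set ν : Pair n → Measure ℝ := fun p => rademacher (A p.1.1 p.1.2) with hν
  set ν' : Pair n → Measure ℝ := fun p => rademacher (A' p.1.1 p.1.2) with hν'
  have fν : IsFeedback A ν := fun p => isSubGaussianWithMean_rademacher (hAb p)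
  have fν' : IsFeedback A' ν' := fun p => isSubGaussianWithMean_rademacher (hAb' p)
  have (p : Pair n) : IsProbabilityMeasure (ν p) := (fν p).prob
  have (p : Pair n) : IsProbabilityMeasure (ν' p) := (fν' p).prob
  refine ⟨ν, fν, ?_⟩
  set L := Real.log (1 / δ) with hL
  have hLpos : 0 < L := Real.log_pos (by rw [lt_div_iff₀ hδ0]; linarith)
  have hexpL : Real.exp (-L) = δ := by
    rw [hL, one_div, Real.log_inv, neg_neg, Real.exp_log hδ0]
  set b := 1 / (800 * D) * L with hb
  have hb0 : 0 ≤ b := by positivity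
  by_contra hlt
  rw [not_le] at hlt
  -- If `E[τ] < b`, Markov's inequality at level `20 b` leaves probability below `1/20` for running
  -- past `T`.
  set T := ⌊20 * b⌋₊ with hT
  have hT1 : 20 * b < T + 1 := Nat.lt_floor_add_one _
  have hT2 : (T : ℝ) ≤ 20 * b := Nat.floor_le (by positivity)
  set V : Set Verdict := {v | v.Correct α A} with hV
  set x := (𝒜.law ν).real (𝒜.concludesBy T V) with hx
  set y := (𝒜.law ν').real (𝒜.concludesBy T V) with hy
  set z := (𝒜.law ν).real (𝒜.runsPast T) with hz
  have hx0 : 0 ≤ x := measureReal_nonneg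
  have hy0 : 0 ≤ y := measureReal_nonneg
  have hz0 : 0 ≤ z := measureReal_nonneg
  have hz1 : z < 1 / 20 := by
    have h1 := (𝒜.mul_law_runsPast_le_expectedTime ν T).trans hlt.le
    rw [← ofReal_measureReal, ← ENNReal.ofReal_natCast, ← ENNReal.ofReal_mul (by positivity),
      ENNReal.ofReal_le_ofReal_iff hb0] at h1
    push_cast at h1
    by_contra hcon
    nlinarith
  have hx1 : 1 - δ ≤ x + z := by
    have h1 : {x | ∃ v : Verdict, 𝒜.Concludes x v ∧ v.Correct α A}
        ⊆ 𝒜.concludesBy T V ∪ 𝒜.runsPast T := by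
      rintro ω ⟨v, ⟨t, ht, ht'⟩, hvA⟩
      rcases le_or_gt t T with h | h
      · exact Or.inl ⟨t, h, ⟨v, hvA, ht⟩, ht'⟩
      · exact Or.inr fun s hs => ht' s (hs.trans_lt h)
    have h2 := (h𝒜 A hA ν fν).trans ((measure_mono h1).trans (measure_union_le _ _))
    rw [← ofReal_measureReal, ← ofReal_measureReal, ← ENNReal.ofReal_add hx0 hz0,
      ENNReal.ofReal_le_ofReal_iff (by positivity)] at h2
    exact h2
  -- A verdict true for `A` is false for `A'`, and a run has only one verdict; so this event is an
  -- error under `A'`.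
  have hy1 : y ≤ δ := by
    have hdisj : Disjoint (𝒜.concludesBy T V)
        {x | ∃ v : Verdict, 𝒜.Concludes x v ∧ v.Correct α A'} := by
      rw [Set.disjoint_left]
      rintro ω ⟨t, -, ⟨v, hvA, hvt⟩, ht⟩ ⟨w, hw, hwA⟩
      have hvw : v = w := Concludes.unique ⟨t, hvt, ht⟩ hw
      exact hv v hvA (hvw ▸ hwA)
    have h1 : 𝒜.law ν' (𝒜.concludesBy T V)
        + 𝒜.law ν' {x | ∃ v : Verdict, 𝒜.Concludes x v ∧ v.Correct α A'} ≤ 1 := by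
      rw [← measure_union' hdisj (𝒜.measurableSet_concludesBy T V)]
      exact prob_le_one
    have h2 := (add_le_add_right (h𝒜 A' hA' ν' fν') _).trans h1
    rw [← ofReal_measureReal, ← ENNReal.ofReal_add hy0 (by linarith), ← ENNReal.ofReal_one,
      ENNReal.ofReal_le_ofReal_iff (by norm_num)] at h2
    linarith
  have hxy : x ^ 2 ≤ Real.exp (2 * D) ^ T * y := by
    have hdom : SecondMomentDom (Measure.pi ν) (Measure.pi ν') (ENNReal.ofReal
        (Real.exp (2 * ∑ p : Pair n, (A p.1.1 p.1.2 - A' p.1.1 p.1.2) ^ 2))) := by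
      rw [Finset.mul_sum, Real.exp_sum, ENNReal.ofReal_prod_of_nonneg fun _ _ => (Real.exp_pos _).le]
      exact SecondMomentDom.pi fun p =>
        secondMomentDom_rademacher ((hAb p).trans (by norm_num)) (hAb' p)
    have h1 := 𝒜.law_concludesBy_sq_le hdom T V
    rw [← ofReal_measureReal, ← ofReal_measureReal, ← ENNReal.ofReal_pow hx0,
      ← ENNReal.ofReal_pow (Real.exp_pos _).le, ← ENNReal.ofReal_mul (by positivity),
      ENNReal.ofReal_le_ofReal_iff (by positivity)] at h1
    refine h1.trans ?_
    gcongr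
  -- `37/60 = 1 - 1/3 - 1/20`.
  have hx2 : (37 / 60 : ℝ) ≤ x := by linarith
  have hfin : x ^ 2 ≤ Real.exp (-(19 / 20 * L)) := by
    calc x ^ 2 ≤ Real.exp (2 * D) ^ T * δ := hxy.trans (by gcongr)
      _ = Real.exp (2 * D * T - L) := by
        rw [← Real.exp_nat_mul, ← hexpL, ← Real.exp_add]; congr 1; ring
      _ ≤ _ := by
        refine Real.exp_le_exp.2 ?_
        have : 2 * D * T ≤ 2 * D * (20 * b) := by gcongr
        -- The constant `800 = 2 · 20 · 20` makes the change of measure cost only a factor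
        -- `δ^(-1/20)`.
        have h2 : 2 * D * (20 * b) = L / 20 := by rw [hb]; field_simp; ring
        linarith
  -- Twentieth powers clear the exponent `19/20`; the contradiction is then numerical, `(37/60)^40 >
  -- (1/3)^19`.
  have hpow : (x ^ 2) ^ 20 ≤ δ ^ 19 := by
    calc (x ^ 2) ^ 20 ≤ Real.exp (-(19 / 20 * L)) ^ 20 := by gcongr
      _ = Real.exp (-L) ^ 19 := by
        rw [← Real.exp_nat_mul, ← Real.exp_nat_mul]; congr 1; push_cast; ring
      _ = δ ^ 19 := by rw [hexpL]
  have h1 : δ ^ 19 ≤ (1 / 3 : ℝ) ^ 19 := by gcongr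
  have h2 : ((37 / 60 : ℝ) ^ 2) ^ 20 ≤ (x ^ 2) ^ 20 := by gcongr
  norm_num at h1 h2
  linarith

end Algorithm

/-! ## Linear algebra of the hard games -/

/-- The entry `(i, k)` of `Q(2m+1, κ, s)`, for indices in `ℕ`. -/
noncomputable def gameEntry (m : ℕ) (κ s : ℝ) (i k : ℕ) : ℝ :=
  if i < k then hardEntry (2 * m + 1) κ s (k - i)
  else if k < i then -hardEntry (2 * m + 1) κ s (i - k)
  else 0

theorem gameEntry_swap (m : ℕ) (κ s : ℝ) (i k : ℕ) :
    gameEntry m κ s k i = -gameEntry m κ s i k := by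
  rcases lt_trichotomy i k with h | h | h
  · simp [gameEntry, h, h.not_gt]
  · simp [gameEntry, h]
  · simp [gameEntry, h, h.not_gt]

theorem hardEntry_near {m : ℕ} (κ s : ℝ) {d : ℕ} (h : d ≤ m) :
    hardEntry (2 * m + 1) κ s d = κ := by
  rw [hardEntry, if_pos (by omega)]

theorem hardEntry_far {m : ℕ} (κ s : ℝ) {d : ℕ} (h : m < d) (h' : d < 2 * m) :
    hardEntry (2 * m + 1) κ s d = -κ := by
  rw [hardEntry, if_neg (by omega), if_pos (by omega)]

theorem hardEntry_last {m : ℕ} (hm : 2 ≤ m) (κ s : ℝ) :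
    hardEntry (2 * m + 1) κ s (2 * m) = -2 * κ + s := by
  rw [hardEntry, if_neg (by omega), if_neg (by omega)]

/-- Neighbouring columns differ only where the diagonal is crossed (rows `k` and `k + 1`), where the
distance passes between `m` and `m + 1` and the sign flips, and at the two corners. -/
theorem gameEntry_succ_sub {m : ℕ} (hm : 2 ≤ m) (κ s : ℝ) {i k : ℕ} (hi : i ≤ 2 * m)
    (hk : k < 2 * m) :
    gameEntry m κ s i (k + 1) - gameEntry m κ s i k =
      (if i = k then κ else 0) + (if i = k + 1 then κ else 0)
      - (if i = (if k < m then k + m + 1 else k - m) then 2 * κ else 0)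
      + (if i = 2 * m then (if k = 0 then s - κ else 0) else 0)
      + (if i = 0 then (if k + 1 = 2 * m then s - κ else 0) else 0) := by
  have near := fun d (h : d ≤ m) => hardEntry_near κ s h
  have far := fun d (h : m < d) (h' : d < 2 * m) => hardEntry_far κ s h h'
  have last := hardEntry_last hm κ s
  have one : ∀ d, 0 < d → d ≤ 2 * m → hardEntry (2 * m + 1) κ s d =
      if d ≤ m then κ else if d = 2 * m then -2 * κ + s else -κ := by
    intro d _ hd
    split_ifs with h1 h2
    · exact near d h1
    · rw [h2]; exact last
    · exact far d (by omega) (by omega)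
  unfold gameEntry
  rcases lt_trichotomy i k with h | h | h
  · rw [if_pos (by omega), if_pos h, one _ (by omega) (by omega), one _ (by omega) (by omega),
      if_neg (show ¬ i = k by omega), if_neg (show ¬ i = k + 1 by omega),
      if_neg (show ¬ i = 2 * m by omega)]
    split_ifs <;> first | omega | ring
  · rw [if_pos (by omega), if_neg (by omega), if_neg (by omega), one _ (by omega) (by omega),
      if_pos h, if_neg (show ¬ i = k + 1 by omega), if_neg (show ¬ i = 2 * m by omega)]
    split_ifs <;> first | omega | ring
  · rcases eq_or_lt_of_le (Nat.succ_le_of_lt h) with h' | h'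
    · rw [if_neg (by omega), if_neg (by omega), if_neg (by omega), if_pos (by omega),
        one _ (by omega) (by omega), if_neg (show ¬ i = k by omega),
        if_pos (show i = k + 1 by omega), if_neg (show ¬ i = 0 by omega)]
      split_ifs <;> first | omega | ring
    · rw [if_neg (by omega), if_pos (by omega), if_neg (by omega), if_pos (by omega),
        one _ (by omega) (by omega), one _ (by omega) (by omega), if_neg (show ¬ i = k by omega),
        if_neg (show ¬ i = k + 1 by omega), if_neg (show ¬ i = 0 by omega)]
      split_ifs <;> first | omega | ring

/-- Entry `k` of `zᵀ Q(2m+1, κ, s)`. -/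
noncomputable def colSum (m : ℕ) (κ s : ℝ) (z : ℕ → ℝ) (k : ℕ) : ℝ :=
  ∑ i ∈ Finset.range (2 * m + 1), z i * gameEntry m κ s i k

theorem colSum_succ_sub {m : ℕ} (hm : 2 ≤ m) (κ s : ℝ) (z : ℕ → ℝ) {k : ℕ} (hk : k < 2 * m) :
    colSum m κ s z (k + 1) - colSum m κ s z k =
      κ * (z k + z (k + 1) - 2 * z (if k < m then k + m + 1 else k - m))
      + (if k = 0 then (s - κ) * z (2 * m) else 0)
      + (if k + 1 = 2 * m then (s - κ) * z 0 else 0) := by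
  have hσ : (if k < m then k + m + 1 else k - m) ∈ Finset.range (2 * m + 1) := by
    rw [Finset.mem_range]; split_ifs <;> omega
  rw [colSum, colSum, ← Finset.sum_sub_distrib]
  rw [Finset.sum_congr rfl fun i hi => by
    rw [← mul_sub, gameEntry_succ_sub hm κ s (by simpa [Nat.lt_succ_iff] using hi) hk]]
  simp only [mul_add, mul_sub, Finset.sum_add_distrib, Finset.sum_sub_distrib, mul_ite, mul_zero,
    Finset.sum_ite_eq', hσ, if_true]
  rw [if_pos (Finset.mem_range.2 (by omega)), if_pos (Finset.mem_range.2 (by omega)),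
    if_pos (Finset.mem_range.2 (by omega)), if_pos (Finset.mem_range.2 (by omega))]
  split_ifs <;> ring

theorem sum_colSum_mul (m : ℕ) (κ s : ℝ) (z w : ℕ → ℝ) :
    ∑ k ∈ Finset.range (2 * m + 1), colSum m κ s z k * w k
      = -∑ k ∈ Finset.range (2 * m + 1), colSum m κ s w k * z k := by
  simp only [colSum, Finset.sum_mul]
  rw [Finset.sum_comm, ← Finset.sum_neg_distrib]
  refine Finset.sum_congr rfl fun i _ => ?_
  rw [← Finset.sum_neg_distrib]
  refine Finset.sum_congr rfl fun k _ => ?_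
  rw [gameEntry_swap m κ s i k]; ring

theorem sum_colSum_mul_self (m : ℕ) (κ s : ℝ) (z : ℕ → ℝ) :
    ∑ k ∈ Finset.range (2 * m + 1), colSum m κ s z k * z k = 0 := by
  linarith [sum_colSum_mul m κ s z z]

/-- The vector `(1, r, …, r, 2 - r, r, …, r, 1)`, which spans the kernel of `Q(2m+1, κ, κ r)`. -/
noncomputable def hardKernel (m : ℕ) (r : ℝ) (i : ℕ) : ℝ :=
  r + (if i = 0 then 1 - r else 0) + (if i = 2 * m then 1 - r else 0)
    + (if i = m then 2 - 2 * r else 0)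

theorem hardKernel_zero {m : ℕ} (hm : 2 ≤ m) (r : ℝ) : hardKernel m r 0 = 1 := by
  rw [hardKernel, if_pos rfl, if_neg (by omega), if_neg (by omega)]; ring

theorem hardKernel_last {m : ℕ} (hm : 2 ≤ m) (r : ℝ) : hardKernel m r (2 * m) = 1 := by
  rw [hardKernel, if_neg (by omega), if_pos rfl, if_neg (by omega)]; ring

theorem hardKernel_middle {m : ℕ} (hm : 2 ≤ m) (r : ℝ) : hardKernel m r m = 2 - r := by
  rw [hardKernel, if_neg (by omega), if_neg (by omega), if_pos rfl]; ring

theorem hardKernel_of_ne {m : ℕ} (r : ℝ) {i : ℕ} (h0 : i ≠ 0) (hm : i ≠ m) (hl : i ≠ 2 * m) :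
    hardKernel m r i = r := by
  rw [hardKernel, if_neg h0, if_neg hl, if_neg hm]; ring

theorem hardKernel_cases {m : ℕ} (hm : 2 ≤ m) (r : ℝ) (i : ℕ) :
    hardKernel m r i = 1 ∨ hardKernel m r i = 2 - r ∨ hardKernel m r i = r := by
  by_cases h0 : i = 0
  · exact Or.inl (h0 ▸ hardKernel_zero hm r)
  by_cases hl : i = 2 * m
  · exact Or.inl (hl ▸ hardKernel_last hm r)
  by_cases h : i = m
  · right; left; rw [h, hardKernel_middle hm]
  · exact Or.inr (Or.inr (hardKernel_of_ne r h0 h hl))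

theorem sum_hardKernel (m : ℕ) (r : ℝ) :
    ∑ i ∈ Finset.range (2 * m + 1), hardKernel m r i = 4 + (2 * m - 3) * r := by
  simp only [hardKernel, Finset.sum_add_distrib, Finset.sum_ite_eq', Finset.sum_const,
    Finset.card_range, nsmul_eq_mul]
  rw [if_pos (Finset.mem_range.2 (by omega)), if_pos (Finset.mem_range.2 (by omega)),
    if_pos (Finset.mem_range.2 (by omega))]
  push_cast; ring

/-- All consecutive differences vanish, so the entries of `zᵀ Q` equal one constant. Pairing with
`z` gives 0 by skew-symmetry, and the sum of `z` is nonzero, so the constant is 0. -/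
theorem colSum_hardKernel {m : ℕ} (hm : 2 ≤ m) (κ : ℝ) {r : ℝ} (hr : 4 + (2 * m - 3) * r ≠ 0)
    {k : ℕ} (hk : k ≤ 2 * m) : colSum m κ (κ * r) (hardKernel m r) k = 0 := by
  have first := hardKernel_zero hm r
  have last := hardKernel_last hm r
  have middle := hardKernel_middle hm r
  have mid : ∀ {j : ℕ}, j ≠ 0 → j ≠ m → j ≠ 2 * m → hardKernel m r j = r :=
    fun h h' h'' => hardKernel_of_ne r h h' h''
  have step : ∀ k < 2 * m, colSum m κ (κ * r) (hardKernel m r) (k + 1)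
      = colSum m κ (κ * r) (hardKernel m r) k := by
    intro k hk
    rw [← sub_eq_zero, colSum_succ_sub hm _ _ _ hk]
    rcases Nat.eq_zero_or_pos k with rfl | h0
    · rw [if_pos (by omega), if_pos rfl, if_neg (by omega), first, mid (by omega) (by omega)
        (by omega), mid (by omega) (by omega) (by omega), last]
      ring
    rw [if_neg (by omega : ¬ k = 0)]
    by_cases hl : k + 1 = 2 * m
    · rw [if_neg (by omega), if_pos hl, mid (by omega) (by omega) (by omega), hl, last, first,
        mid (by omega) (by omega) (by omega)]
      ring
    rw [if_neg hl]
    by_cases hkm : k = m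
    · rw [if_neg (by omega), hkm, Nat.sub_self, middle, first, mid (by omega) (by omega) (by omega)]
      ring
    by_cases hkm' : k + 1 = m
    · rw [if_pos (by omega), mid (by omega) (by omega) (by omega), hkm', middle,
        show k + m + 1 = 2 * m by omega, last]
      ring
    · rw [mid (by omega) (by omega) (by omega), mid (by omega) (by omega) (by omega)]
      split_ifs <;> rw [mid (by omega) (by omega) (by omega)] <;> ring
  have const : ∀ k ≤ 2 * m, colSum m κ (κ * r) (hardKernel m r) k
      = colSum m κ (κ * r) (hardKernel m r) 0 := by
    intro k
    induction k with
    | zero => intro _; rfl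
    | succ k ih => intro h; rw [step k (by omega), ih (by omega)]
  have h0 := sum_colSum_mul_self m κ (κ * r) (hardKernel m r)
  rw [Finset.sum_congr rfl fun k hk => by
    rw [const k (by simpa [Nat.lt_succ_iff] using hk)], ← Finset.mul_sum, sum_hardKernel] at h0
  rw [const k hk]
  exact (mul_eq_zero.1 h0).resolve_right hr

/-- Except in the first column, the entries of `zᵀ Q(2m+1, κ, s)` do not depend on `s` if
`z 0 = 0`. -/
theorem colSum_eq_mul {m : ℕ} (κ s : ℝ) {z : ℕ → ℝ} (hz : z 0 = 0) {k : ℕ}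
    (hk0 : k ≠ 0) (hk : k ≤ 2 * m) : colSum m κ s z k = κ * colSum m 1 1 z k := by
  rw [colSum, colSum, Finset.mul_sum]
  refine Finset.sum_congr rfl fun i hi => ?_
  have hi' : i ≤ 2 * m := by simpa [Nat.lt_succ_iff] using hi
  rcases Nat.eq_zero_or_pos i with rfl | h
  · simp [hz]
  -- `s` enters only at `(0, 2m)`, excluded as `i > 0`, and at `(2m, 0)`, excluded as `k ≠ 0`.
  · have : gameEntry m κ s i k = κ * gameEntry m 1 1 i k := by
      unfold gameEntry hardEntry
      split_ifs <;> first | omega | ring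
    rw [this]; ring

/-- At `κ = s = 1` the game is circulant and the corner terms disappear. The kernel equations then
say that `z` is an arithmetic progression along the cycle `0, m+1, 1, m+2, 2, …, 2m, m`; closing the
cycle kills the common difference. -/
theorem eq_zero_of_colSum_eq_zero {m : ℕ} (hm : 2 ≤ m) {z : ℕ → ℝ} (hz : z 0 = 0)
    (h : ∀ k ≠ 0, k ≤ 2 * m → colSum m 1 1 z k = 0) {i : ℕ} (hi : i ≤ 2 * m) : z i = 0 := by
  have hker : ∀ k ≤ 2 * m, colSum m 1 1 (fun _ => 1) k = 0 := by
    intro k hk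
    have h1 := colSum_hardKernel hm 1 (r := 1) (by
      have : (2 : ℝ) ≤ m := by exact_mod_cast hm
      nlinarith) hk
    have h2 : hardKernel m 1 = fun _ => 1 := by ext i; simp [hardKernel]
    rwa [h2, mul_one] at h1
  -- The missing column is recovered by pairing with the all-one kernel vector.
  have hz0 : colSum m 1 1 z 0 = 0 := by
    have h1 := sum_colSum_mul m 1 1 z (fun _ => 1)
    have h2 : ∑ k ∈ Finset.range (2 * m + 1), colSum m 1 1 (fun _ => 1) k * z k = 0 :=
      Finset.sum_eq_zero fun k hk => by
        rw [hker k (by simpa [Nat.lt_succ_iff] using hk), zero_mul]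
    have h3 : ∑ k ∈ Finset.range (2 * m), colSum m 1 1 z (k + 1) * 1 = 0 :=
      Finset.sum_eq_zero fun k hk => by
        rw [h (k + 1) (by omega) (by have := Finset.mem_range.1 hk; omega), zero_mul]
    rw [h2, Finset.sum_range_succ', h3] at h1
    simpa using h1
  have hall : ∀ k ≤ 2 * m, colSum m 1 1 z k = 0 := fun k hk => by
    rcases eq_or_ne k 0 with rfl | h'
    · exact hz0
    · exact h k h' hk
  have rel : ∀ k < 2 * m, z k + z (k + 1) = 2 * z (if k < m then k + m + 1 else k - m) := by
    intro k hk
    have := colSum_succ_sub hm 1 1 z hk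
    rw [hall k hk.le, hall (k + 1) hk] at this
    simp only [sub_self, zero_mul, ite_self, add_zero, one_mul] at this
    linarith
  set d := z (m + 1) with hd
  have prog : ∀ j, (j ≤ m → z j = 2 * j * d) ∧ (j + m + 1 ≤ 2 * m → z (j + m + 1)
      = (2 * j + 1) * d) := by
    intro j
    induction j with
    | zero => simp [hz, hd]
    | succ j ih =>
      have hj1 : j + 1 ≤ m → z (j + 1) = 2 * (j + 1 : ℕ) * d := by
        intro hj
        have h1 := rel j (by omega)
        rw [if_pos (by omega), ih.1 (by omega), ih.2 (by omega)] at h1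
        push_cast; linarith
      refine ⟨hj1, fun hj => ?_⟩
      have h1 := rel (j + m + 1) (by omega)
      rw [if_neg (by omega), show j + m + 1 - m = j + 1 by omega, hj1 (by omega),
        ih.2 (by omega)] at h1
      rw [show j + 1 + m + 1 = j + m + 1 + 1 by omega]
      push_cast at h1 ⊢; linarith
  -- Relation `k = m` closes the cycle: `2 m d + d = 2 z 0 = 0`.
  have hd0 : d = 0 := by
    have h1 := rel m (by omega)
    rw [if_neg (by omega), Nat.sub_self, hz, (prog m).1 le_rfl, ← hd] at h1
    have h2 : (2 * (m : ℝ) + 1) * d = 0 := by linarith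
    exact (mul_eq_zero.1 h2).resolve_left (by positivity)
  rcases le_or_gt i m with hi' | hi'
  · rw [(prog i).1 hi', hd0, mul_zero]
  · have := (prog (i - m - 1)).2 (by omega)
    rw [show i - m - 1 + m + 1 = i by omega, hd0, mul_zero] at this
    exact this

/-! ## Skew-symmetric games -/

section Skew

variable {n : ℕ} {A : Matrix (Fin n) (Fin n) ℝ}

theorem mulVec_eq_neg_vecMul (hA : Aᵀ = -A) (x : Fin n → ℝ) : A *ᵥ x = -(x ᵥ* A) := by
  rw [← Matrix.mulVec_transpose, hA, Matrix.neg_mulVec, neg_neg]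

theorem dotProduct_mulVec_self (hA : Aᵀ = -A) (x : Fin n → ℝ) : x ⬝ᵥ (A *ᵥ x) = 0 := by
  have h : x ⬝ᵥ (A *ᵥ x) = -(x ⬝ᵥ (A *ᵥ x)) := by
    conv_lhs => rw [mulVec_eq_neg_vecMul hA, dotProduct_neg, dotProduct_comm,
      ← Matrix.dotProduct_mulVec]
  linarith

/-- Von Neumann: a symmetric zero-sum game has a Nash equilibrium. -/
theorem exists_isNash [NeZero n] (hA : Aᵀ = -A) : ∃ x, IsNash A x := by
  have hne : (stdSimplex ℝ (Fin n)).Nonempty := ⟨_, single_mem_stdSimplex ℝ (0 : Fin n)⟩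
  have hconv := convex_stdSimplex ℝ (Fin n)
  have hlin : ∀ y, IsLinearMap ℝ fun x : Fin n → ℝ => -(x ⬝ᵥ (A *ᵥ y)) := fun y =>
    ⟨fun a b => by rw [add_dotProduct]; ring, fun c a => by simp⟩
  have hlin' : ∀ x, IsLinearMap ℝ fun y : Fin n → ℝ => -(x ⬝ᵥ (A *ᵥ y)) := fun x =>
    ⟨fun a b => by rw [Matrix.mulVec_add, dotProduct_add]; ring,
      fun c a => by simp [Matrix.mulVec_smul]⟩
  obtain ⟨a, ha, b, hb, hab⟩ := Sion.exists_isSaddlePointOn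
    (f := fun x y : Fin n → ℝ => -(x ⬝ᵥ (A *ᵥ y))) hne hconv (isCompact_stdSimplex ℝ (Fin n))
    (fun y _ => (hlin y).mk'.continuous_of_finiteDimensional.lowerSemicontinuous.lowerSemicontinuousOn
      _)
    (fun y _ => ((hlin y).mk'.convexOn hconv).quasiconvexOn)
    hconv hne (isCompact_stdSimplex ℝ (Fin n))
    (fun x _ =>
      (hlin' x).mk'.continuous_of_finiteDimensional.upperSemicontinuous.upperSemicontinuousOn _)
    (fun x _ => ((hlin' x).mk'.concaveOn hconv).quasiconcaveOn)
  refine ⟨a, ha, fun y hy => ?_⟩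
  -- Testing the saddle point against the strategy `b` itself: by skew-symmetry `b` earns 0 against
  -- `b`, so the value bounds `a` from below by 0.
  have := hab b hb y hy
  simp only [dotProduct_mulVec_self hA b] at this
  linarith

theorem IsNash.vecMul_nonneg {x : Fin n → ℝ} (hx : IsNash A x) (k : Fin n) : 0 ≤ (x ᵥ* A) k := by
  have := hx.2 (Pi.single k 1) (single_mem_stdSimplex ℝ k)
  rwa [Matrix.dotProduct_mulVec, dotProduct_single, mul_one] at this

/-- Complementary slackness for an equilibrium with full support. -/
theorem IsNash.vecMul_eq_zero (hA : Aᵀ = -A) {x : Fin n → ℝ} (hx : IsNash A x)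
    (hpos : ∀ i, 0 < x i) : x ᵥ* A = 0 := by
  have h := dotProduct_mulVec_self hA x
  rw [Matrix.dotProduct_mulVec, dotProduct,
    Finset.sum_eq_zero_iff_of_nonneg fun k _ => mul_nonneg (hx.vecMul_nonneg k) (hpos k).le] at h
  ext k
  exact (mul_eq_zero.1 (h k (Finset.mem_univ k))).resolve_right (hpos k).ne'

end Skew

/-! ## Games with a one-dimensional kernel -/

/-- `A` is skew-symmetric and its kernel is spanned by `x`, which has a nonzero sum. -/
structure KernelSpannedBy {n : ℕ} (A : Matrix (Fin n) (Fin n) ℝ) (x : Fin n → ℝ) : Prop where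
  skew : Aᵀ = -A
  vecMul_eq : x ᵥ* A = 0
  span : ∀ z : Fin n → ℝ, z ᵥ* A = 0 → ∃ c : ℝ, z = c • x
  sum_ne : ∑ i, x i ≠ 0

namespace KernelSpannedBy

variable {n : ℕ} {A : Matrix (Fin n) (Fin n) ℝ} {x : Fin n → ℝ}

theorem mulVec_eq (h : KernelSpannedBy A x) : A *ᵥ x = 0 := by
  rw [mulVec_eq_neg_vecMul h.skew, h.vecMul_eq, neg_zero]

theorem sum_vecMul_mul (h : KernelSpannedBy A x) (z : Fin n → ℝ) :
    ∑ k, (z ᵥ* A) k * x k = 0 := by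
  change (z ᵥ* A) ⬝ᵥ x = 0
  rw [← Matrix.dotProduct_mulVec, h.mulVec_eq, dotProduct_zero]

theorem ne_zero (h : KernelSpannedBy A x) : x ≠ 0 := fun hx => h.sum_ne (by simp [hx])

theorem rank_eq (h : KernelSpannedBy A x) : A.rank = n - 1 := by
  have hker : LinearMap.ker A.mulVecLin = Submodule.span ℝ {x} := by
    ext z
    rw [LinearMap.mem_ker, Matrix.mulVecLin_apply, Submodule.mem_span_singleton,
      mulVec_eq_neg_vecMul h.skew, neg_eq_zero]
    constructor
    · intro hz
      obtain ⟨c, hc⟩ := h.span z hz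
      exact ⟨c, hc.symm⟩
    · rintro ⟨c, rfl⟩
      rw [Matrix.smul_vecMul, h.vecMul_eq, smul_zero]
  have h1 := LinearMap.finrank_range_add_finrank_ker A.mulVecLin
  rw [hker, finrank_span_singleton h.ne_zero, Module.finrank_fintype_fun_eq_card,
    Fintype.card_fin] at h1
  rw [Matrix.rank]
  omega

theorem kernelVec_eq (h : KernelSpannedBy A x) : kernelVec A = (∑ i, x i)⁻¹ • x := by
  have hex : ∃ y : Fin n → ℝ, y ᵥ* A = 0 ∧ ∑ i, y i = 1 := by
    refine ⟨(∑ i, x i)⁻¹ • x, by rw [Matrix.smul_vecMul, h.vecMul_eq, smul_zero], ?_⟩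
    simp only [Pi.smul_apply, smul_eq_mul, ← Finset.mul_sum]
    exact inv_mul_cancel₀ h.sum_ne
  rw [kernelVec, dif_pos hex]
  obtain ⟨h1, h2⟩ := hex.choose_spec
  obtain ⟨c, hc⟩ := h.span _ h1
  rw [hc] at h2 ⊢
  simp only [Pi.smul_apply, smul_eq_mul, ← Finset.mul_sum] at h2
  rw [eq_inv_of_mul_eq_one_left h2]

theorem kernelVec_vecMul (h : KernelSpannedBy A x) : kernelVec A ᵥ* A = 0 := by
  rw [h.kernelVec_eq, Matrix.smul_vecMul, h.vecMul_eq, smul_zero]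

theorem sum_kernelVec (h : KernelSpannedBy A x) : ∑ i, kernelVec A i = 1 := by
  rw [h.kernelVec_eq]
  simp only [Pi.smul_apply, smul_eq_mul, ← Finset.mul_sum]
  exact inv_mul_cancel₀ h.sum_ne

theorem smul (h : KernelSpannedBy A x) {c : ℝ} (hc : c ≠ 0) : KernelSpannedBy (c • A) x where
  skew := by rw [Matrix.transpose_smul, h.skew, smul_neg]
  vecMul_eq := by rw [Matrix.vecMul_smul, h.vecMul_eq, smul_zero]
  span z hz := by
    rw [Matrix.vecMul_smul] at hz
    exact h.span z ((smul_eq_zero.1 hz).resolve_left hc)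
  sum_ne := h.sum_ne

end KernelSpannedBy

theorem vecMul_colOne {n : ℕ} (A : Matrix (Fin n) (Fin n) ℝ) (j k : Fin n) (y : Fin n → ℝ) :
    (y ᵥ* colOne A j) k = if k = j then ∑ i, y i else (y ᵥ* A) k := by
  simp only [Matrix.vecMul, dotProduct, colOne, Matrix.updateCol_apply]
  split_ifs <;> simp

namespace KernelSpannedBy

variable {n : ℕ} {A : Matrix (Fin n) (Fin n) ℝ} {x : Fin n → ℝ}

/-- A left null vector `z` of `A_j` has sum 0 and `(zᵀ A)_k = 0` off `j`. Pairing with `x`, where `x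
j ≠ 0`, gives the entry `j` too. So `z` is a multiple of `x`, and its zero sum makes it 0. -/
theorem isUnit_det_colOne (h : KernelSpannedBy A x) {j : Fin n} (hj : x j ≠ 0) :
    IsUnit (colOne A j).det := by
  rw [isUnit_iff_ne_zero]
  intro hdet
  obtain ⟨z, hz0, hz⟩ := Matrix.exists_vecMul_eq_zero_iff.2 hdet
  have hk : ∀ k, k ≠ j → (z ᵥ* A) k = 0 := fun k hk => by
    have := congrFun hz k
    rwa [vecMul_colOne, if_neg hk] at this
  have hsum : ∑ i, z i = 0 := by
    have := congrFun hz j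
    rwa [vecMul_colOne, if_pos rfl] at this
  have hzj : (z ᵥ* A) j = 0 := by
    have h1 := h.sum_vecMul_mul z
    rw [Finset.sum_eq_single j (fun k _ hkj => by rw [hk k hkj, zero_mul]) (by simp)] at h1
    exact (mul_eq_zero.1 h1).resolve_right hj
  obtain ⟨c, rfl⟩ := h.span z <| by
    ext k
    rcases eq_or_ne k j with rfl | hkj
    · exact hzj
    · exact hk k hkj
  simp only [Pi.smul_apply, smul_eq_mul, ← Finset.mul_sum] at hsum
  have hc : c = 0 := (mul_eq_zero.1 hsum).resolve_right h.sum_ne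
  exact hz0 (by rw [hc, zero_smul])

theorem one_vecMul_inv_eq_iff (h : KernelSpannedBy A x) {j : Fin n} (hj : x j ≠ 0)
    {y : Fin n → ℝ} : (1 : Fin n → ℝ) ᵥ* (colOne A j)⁻¹ = y ↔ y ᵥ* colOne A j = 1 := by
  have hu := h.isUnit_det_colOne hj
  constructor
  · rintro rfl
    rw [Matrix.vecMul_vecMul, Matrix.nonsing_inv_mul _ hu, Matrix.vecMul_one]
  · intro hy
    rw [← hy, Matrix.vecMul_vecMul, Matrix.mul_nonsing_inv _ hu, Matrix.vecMul_one]

/-- The vectors `1ᵀ A_j⁻¹ - πᵀ` whose entries enter `φ(A)`. -/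
theorem sensitivity_spec (h : KernelSpannedBy A x) {j : Fin n} (hj : x j ≠ 0) :
    (∀ k ≠ j, (((1 : Fin n → ℝ) ᵥ* (colOne A j)⁻¹ - kernelVec A) ᵥ* A) k = 1) ∧
      ∑ i, ((1 : Fin n → ℝ) ᵥ* (colOne A j)⁻¹ - kernelVec A) i = 0 := by
  have hy := (h.one_vecMul_inv_eq_iff hj).1 rfl
  constructor
  · intro k hk
    have := congrFun hy k
    rw [vecMul_colOne, if_neg hk] at this
    rw [Matrix.sub_vecMul, h.kernelVec_vecMul, sub_zero, this, Pi.one_apply]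
  · have := congrFun hy j
    rw [vecMul_colOne, if_pos rfl] at this
    simp only [Pi.sub_apply, Finset.sum_sub_distrib, this, h.sum_kernelVec, Pi.one_apply, sub_self]

/-- By `sensitivity_spec` the vector `1ᵀ A_j⁻¹ - πᵀ` has zero sum and image 1 off `j`; these
conditions determine it. Scaling `A` by `c` keeps `π` and divides that vector by `c`. -/
theorem phi_smul (h : KernelSpannedBy A x) (hx : ∀ j, x j ≠ 0) {c : ℝ} (hc : 0 < c) :
    phi (c • A) = phi A / c := by
  have hker : kernelVec (c • A) = kernelVec A := by
    rw [(h.smul hc.ne').kernelVec_eq, h.kernelVec_eq]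
  have key : ∀ j i, ((1 : Fin n → ℝ) ᵥ* (colOne (c • A) j)⁻¹) i - kernelVec (c • A) i
      = c⁻¹ * (((1 : Fin n → ℝ) ᵥ* (colOne A j)⁻¹) i - kernelVec A i) := by
    intro j i
    obtain ⟨h1, h2⟩ := h.sensitivity_spec (hx j)
    have : (1 : Fin n → ℝ) ᵥ* (colOne (c • A) j)⁻¹
        = kernelVec A + c⁻¹ • ((1 : Fin n → ℝ) ᵥ* (colOne A j)⁻¹ - kernelVec A) := by
      rw [(h.smul hc.ne').one_vecMul_inv_eq_iff (hx j)]
      ext k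
      rw [vecMul_colOne]
      split_ifs with hk
      · simp only [Pi.add_apply, Pi.smul_apply, smul_eq_mul, Finset.sum_add_distrib,
          ← Finset.mul_sum, h2, h.sum_kernelVec, Pi.one_apply, mul_zero, add_zero]
      · rw [Matrix.vecMul_smul, Matrix.add_vecMul, h.kernelVec_vecMul, Matrix.smul_vecMul, zero_add,
          smul_smul, mul_inv_cancel₀ hc.ne', one_smul, h1 k hk, Pi.one_apply]
    rw [this, hker]
    simp
  unfold phi
  simp only [key, abs_mul, abs_of_pos (inv_pos.2 hc)]
  rw [div_eq_inv_mul, Real.mul_iSup_of_nonneg (inv_pos.2 hc).le]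
  refine iSup_congr fun j => ?_
  rw [Real.mul_iSup_of_nonneg (inv_pos.2 hc).le]

theorem phi_pos (h : KernelSpannedBy A x) (hx : ∀ j, x j ≠ 0) (hn : 2 ≤ n) : 0 < phi A := by
  by_contra hle
  rw [not_lt] at hle
  let j : Fin n := ⟨0, by omega⟩
  let k : Fin n := ⟨1, by omega⟩
  obtain ⟨h1, -⟩ := h.sensitivity_spec (hx j)
  have hz : (1 : Fin n → ℝ) ᵥ* (colOne A j)⁻¹ - kernelVec A = 0 := by
    ext i
    have h2 : |((1 : Fin n → ℝ) ᵥ* (colOne A j)⁻¹) i - kernelVec A i| ≤ phi A :=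
      (le_ciSup (f := fun i => |((1 : Fin n → ℝ) ᵥ* (colOne A j)⁻¹) i - kernelVec A i|)
        (Set.finite_range _).bddAbove i).trans
      (le_ciSup (f := fun j => ⨆ i, |((1 : Fin n → ℝ) ᵥ* (colOne A j)⁻¹) i - kernelVec A i|)
        (Set.finite_range _).bddAbove j)
    exact abs_nonpos_iff.1 (h2.trans hle)
  have h3 := h1 k (by simp [j, k])
  rw [hz, Matrix.zero_vecMul] at h3
  norm_num at h3

end KernelSpannedBy

theorem phi_nonneg {n : ℕ} (A : Matrix (Fin n) (Fin n) ℝ) : 0 ≤ phi A :=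
  Real.iSup_nonneg fun _ => Real.iSup_nonneg fun _ => abs_nonneg _

/-! ## The hard games as games -/

/-- `hardKernel` as a vector. -/
noncomputable def hardVec (m : ℕ) (r : ℝ) : Fin (2 * m + 1) → ℝ := fun i => hardKernel m r i

theorem vecMul_hardGame (m : ℕ) (κ s : ℝ) (z : ℕ → ℝ) (k : Fin (2 * m + 1)) :
    ((fun i : Fin (2 * m + 1) => z i) ᵥ* hardGame (2 * m + 1) κ s) k = colSum m κ s z k := by
  rw [colSum, Finset.sum_range]
  rfl

theorem exists_nat_extension {N : ℕ} (v : Fin N → ℝ) : ∃ z : ℕ → ℝ, v = fun i : Fin N => z i :=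
  ⟨fun i => if h : i < N then v ⟨i, h⟩ else 0, by ext i; simp⟩

theorem hardGame_skew (n : ℕ) (κ s : ℝ) : (hardGame n κ s)ᵀ = -hardGame n κ s := by
  ext i j
  simp only [Matrix.transpose_apply, Matrix.neg_apply, hardGame]
  rcases lt_trichotomy i j with h | h | h
  · rw [if_neg h.not_gt, if_pos h, if_pos h]
  · simp [h]
  · rw [if_pos h, if_neg h.not_gt, if_pos h, neg_neg]

theorem hardGame_mul (n : ℕ) (κ r : ℝ) : hardGame n κ (κ * r) = κ • hardGame n 1 r := by
  ext i j
  simp only [Matrix.smul_apply, smul_eq_mul, hardGame, hardEntry]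
  split_ifs <;> ring

/-- The map that sends `z` to `zᵀ Q` is bounded below on vectors with `z 0 = 0`, uniformly in the
perturbation parameter. -/
theorem exists_hardGame_coercive {m : ℕ} (hm : 2 ≤ m) : ∃ K > (0 : ℝ), ∀ κ > (0 : ℝ), ∀ s : ℝ,
    ∀ v : Fin (2 * m + 1) → ℝ, v 0 = 0 → ∀ B : ℝ, 0 ≤ B →
    (∀ k ≠ 0, |(v ᵥ* hardGame (2 * m + 1) κ s) k| ≤ B) → ∀ i, κ * |v i| ≤ K * B := by
  -- By `colSum_eq_mul` a single map, built from `Q(n, 1, 1)`, serves all `κ` and `s`. Recording `v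
  -- 0` in place of entry 0 makes it injective, hence bounded below in finite dimension.
  let f : (Fin (2 * m + 1) → ℝ) →ₗ[ℝ] (Fin (2 * m + 1) → ℝ) :=
    { toFun := fun v k => if k = 0 then v 0 else (v ᵥ* hardGame (2 * m + 1) 1 1) k
      map_add' := fun v w => by
        ext k; by_cases hk : k = 0 <;> simp [hk, Matrix.add_vecMul]
      map_smul' := fun c v => by
        ext k; by_cases hk : k = 0 <;> simp [hk, Matrix.smul_vecMul] }
  have hf : ∀ v k, f v k = if k = 0 then v 0 else (v ᵥ* hardGame (2 * m + 1) 1 1) k :=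
    fun _ _ => rfl
  have hker : LinearMap.ker f = ⊥ := by
    rw [LinearMap.ker_eq_bot']
    intro v hv
    obtain ⟨z, rfl⟩ := exists_nat_extension v
    have h0 := congrFun hv 0
    rw [hf, if_pos rfl] at h0
    ext i
    refine eq_zero_of_colSum_eq_zero hm (by simpa using h0) (fun k hk hk' => ?_)
      (Nat.lt_succ_iff.1 i.2)
    have h1 := congrFun hv ⟨k, Nat.lt_succ_iff.2 hk'⟩
    rw [hf, if_neg (by simpa [Fin.ext_iff] using hk), vecMul_hardGame] at h1
    exact h1
  obtain ⟨K, hK0, hK⟩ := f.exists_antilipschitzWith hker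
  refine ⟨K, by exact_mod_cast hK0, fun κ hκ s v hv0 B hB hv i => ?_⟩
  have h1 : ‖v‖ ≤ K * ‖f v‖ := ZeroHomClass.bound_of_antilipschitz f hK v
  have h2 : ‖f v‖ ≤ B / κ := by
    refine (pi_norm_le_iff_of_nonneg (by positivity)).2 fun k => ?_
    rw [hf]
    split_ifs with hk
    · rw [hv0, norm_zero]; positivity
    · have h3 := hv k hk
      obtain ⟨z, rfl⟩ := exists_nat_extension v
      rw [vecMul_hardGame, colSum_eq_mul κ s hv0 (fun h => hk (Fin.ext h))
        (Nat.lt_succ_iff.1 k.2), abs_mul, abs_of_pos hκ] at h3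
      rw [vecMul_hardGame, Real.norm_eq_abs, le_div_iff₀ hκ, mul_comm]
      exact h3
  have h3 : |v i| ≤ K * (B / κ) := by
    rw [← Real.norm_eq_abs]
    exact (norm_le_pi_norm v i).trans (h1.trans (by gcongr))
  calc κ * |v i| ≤ κ * (K * (B / κ)) := by gcongr
    _ = K * B := by field_simp

theorem sum_hardVec (m : ℕ) (r : ℝ) : ∑ i, hardVec m r i = 4 + (2 * m - 3) * r := by
  rw [← sum_hardKernel, Finset.sum_range]; rfl

theorem hardVec_zero {m : ℕ} (hm : 2 ≤ m) (r : ℝ) : hardVec m r 0 = 1 := hardKernel_zero hm r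

/-- The admissible range of `r` for the perturbation `κ r` of the hard games. -/
theorem perturbation_bounds {m : ℕ} (hm : 2 ≤ m) {r : ℝ} (hr : |r| * (2 * m + 1) ≤ 1) :
    |r| ≤ 1 / 5 ∧ |(2 * m - 3) * r| ≤ 1 := by
  have h := abs_nonneg r
  have hm' : (2 : ℝ) ≤ m := by exact_mod_cast hm
  constructor
  · nlinarith
  · rw [abs_mul, abs_of_nonneg (by linarith)]
    nlinarith

theorem sum_hardVec_bounds {m : ℕ} (hm : 2 ≤ m) {r : ℝ} (hr : |r| * (2 * m + 1) ≤ 1) :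
    3 ≤ ∑ i, hardVec m r i ∧ ∑ i, hardVec m r i ≤ 5 := by
  have h := abs_le.1 (perturbation_bounds hm hr).2
  rw [sum_hardVec]
  constructor <;> linarith

theorem hardVec_abs_bounds {m : ℕ} (hm : 2 ≤ m) {r : ℝ} (hr : |r| * (2 * m + 1) ≤ 1)
    (i : Fin (2 * m + 1)) : |r| ≤ |hardVec m r i| ∧ |hardVec m r i| ≤ 3 := by
  have h := (perturbation_bounds hm hr).1
  have h' := abs_le.1 h
  rcases hardKernel_cases hm r i with hi | hi | hi
  · rw [hardVec, hi, abs_one]; constructor <;> linarith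
  · rw [hardVec, hi, abs_of_nonneg (show 0 ≤ 2 - r by linarith)]; constructor <;> linarith
  · rw [hardVec, hi]; constructor <;> linarith

theorem hardVec_ne_zero {m : ℕ} (hm : 2 ≤ m) {r : ℝ} (hr : |r| * (2 * m + 1) ≤ 1) (hr0 : r ≠ 0)
    (i : Fin (2 * m + 1)) : hardVec m r i ≠ 0 :=
  abs_pos.1 ((abs_pos.2 hr0).trans_le (hardVec_abs_bounds hm hr i).1)

theorem hardVec_vecMul {m : ℕ} (hm : 2 ≤ m) (κ : ℝ) {r : ℝ} (hr : |r| * (2 * m + 1) ≤ 1) :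
    hardVec m r ᵥ* hardGame (2 * m + 1) κ (κ * r) = 0 := by
  have h := sum_hardVec_bounds hm hr
  rw [sum_hardVec] at h
  ext k
  exact (vecMul_hardGame m κ (κ * r) (hardKernel m r) k).trans
    (colSum_hardKernel hm κ (by linarith [h.1]) (Nat.lt_succ_iff.1 k.2))

/-- Since `hardVec` starts with 1, subtracting `z 0` times it from a kernel vector `z` leaves a
kernel vector with first entry 0, which vanishes by coercivity with bound 0. -/
theorem kernelSpannedBy_hardGame {m : ℕ} (hm : 2 ≤ m) {κ r : ℝ} (hκ : 0 < κ)
    (hr : |r| * (2 * m + 1) ≤ 1) :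
    KernelSpannedBy (hardGame (2 * m + 1) κ (κ * r)) (hardVec m r) where
  skew := hardGame_skew _ _ _
  vecMul_eq := hardVec_vecMul hm κ hr
  span z hz := by
    obtain ⟨K, -, hK⟩ := exists_hardGame_coercive hm
    refine ⟨z 0, ?_⟩
    have h1 := hK κ hκ (κ * r) (z - z 0 • hardVec m r) (by simp [hardVec_zero hm]) 0 le_rfl
      (fun k _ => by
        rw [Matrix.sub_vecMul, hz, Matrix.smul_vecMul, hardVec_vecMul hm κ hr]; simp)
    ext i
    have h2 : |(z - z 0 • hardVec m r) i| ≤ 0 := by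
      have := h1 i
      rw [mul_zero] at this
      exact nonpos_of_mul_nonpos_right this hκ
    exact sub_eq_zero.1 (abs_nonpos_iff.1 h2)
  sum_ne := by linarith [(sum_hardVec_bounds hm hr).1]

theorem abs_hardGame_le {m : ℕ} (hm : 2 ≤ m) {κ r : ℝ} (hκ : 0 < κ) (hκ' : κ ≤ 1 / 4)
    (hr : |r| * (2 * m + 1) ≤ 1) (i j : Fin (2 * m + 1)) :
    |hardGame (2 * m + 1) κ (κ * r) i j| ≤ 3 / 5 := by
  have h := abs_le.1 (perturbation_bounds hm hr).1
  -- The extreme entry is the corner, at most `κ (2 + |r|) ≤ (1/4) (11/5) < 3/5`.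
  have hentry : ∀ d, |hardEntry (2 * m + 1) κ (κ * r) d| ≤ 3 / 5 := by
    intro d
    unfold hardEntry
    rw [abs_le]
    split_ifs <;> constructor <;> nlinarith
  unfold hardGame
  split_ifs
  · exact hentry _
  · rw [abs_neg]; exact hentry _
  · norm_num

theorem isAdmissible_hardGame {m : ℕ} (hm : 2 ≤ m) {κ r : ℝ} (hκ : 0 < κ) (hκ' : κ ≤ 1 / 4)
    (hr : |r| * (2 * m + 1) ≤ 1) : IsAdmissible (hardGame (2 * m + 1) κ (κ * r)) where
  odd := ⟨m, rfl⟩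
  three_le := by omega
  bounded i j := by
    have := abs_le.1 (abs_hardGame_le hm hκ hκ' hr i j)
    constructor <;> linarith
  skew := hardGame_skew _ _ _
  rank_eq := (kernelSpannedBy_hardGame hm hκ hr).rank_eq
  exists_kernel := ⟨_, hardVec_vecMul hm κ hr, (kernelSpannedBy_hardGame hm hκ hr).sum_ne⟩

/-! ### Scaling and size of `φ` on the hard games. -/

theorem phi_hardGame {m : ℕ} (hm : 2 ≤ m) {κ r : ℝ} (hκ : 0 < κ) (hr : |r| * (2 * m + 1) ≤ 1)
    (hr0 : r ≠ 0) :
    phi (hardGame (2 * m + 1) κ (κ * r)) = phi (hardGame (2 * m + 1) 1 r) / κ := by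
  have h := kernelSpannedBy_hardGame hm one_pos hr
  rw [one_mul] at h
  rw [hardGame_mul, h.phi_smul (hardVec_ne_zero hm hr hr0) hκ]

theorem phi_hardGame_one_pos {m : ℕ} (hm : 2 ≤ m) {r : ℝ} (hr : |r| * (2 * m + 1) ≤ 1)
    (hr0 : r ≠ 0) : 0 < phi (hardGame (2 * m + 1) 1 r) := by
  have h := kernelSpannedBy_hardGame hm one_pos hr
  rw [one_mul] at h
  exact h.phi_pos (hardVec_ne_zero hm hr hr0) (by omega)

/-- For `z = 1ᵀ A_j⁻¹ - πᵀ` only `(zᵀ A)_j` is unknown, and pairing with the kernel vector bounds it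
by `6 / |r|`. Coercivity then bounds `z` minus its kernel component `z 0 • hardVec`, and `∑ z = 0`
bounds `z 0`. -/
theorem exists_phi_hardGame_le {m : ℕ} (hm : 2 ≤ m) : ∃ C > (0 : ℝ), ∀ κ > (0 : ℝ), ∀ r : ℝ,
    |r| * (2 * m + 1) ≤ 1 → r ≠ 0 →
    phi (hardGame (2 * m + 1) κ (κ * r)) ≤ C / (κ * |r|) := by
  obtain ⟨K, hK0, hK⟩ := exists_hardGame_coercive hm
  refine ⟨6 * K * (2 * m + 2), by positivity, fun κ hκ r hr hr0 => ?_⟩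
  have hA := kernelSpannedBy_hardGame hm hκ hr
  set A := hardGame (2 * m + 1) κ (κ * r) with hAdef
  have hrpos : 0 < |r| := abs_pos.2 hr0
  have hr1 : |r| ≤ 1 / 5 := (perturbation_bounds hm hr).1
  obtain ⟨hX1, hX2⟩ := sum_hardVec_bounds hm hr
  set X := ∑ i, hardVec m r i with hX
  refine ciSup_le fun j => ciSup_le fun i => ?_
  obtain ⟨h1, h2⟩ := hA.sensitivity_spec (hardVec_ne_zero hm hr hr0 j)
  change |((1 : Fin (2 * m + 1) → ℝ) ᵥ* (colOne A j)⁻¹ - kernelVec A) i| ≤ _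
  set z := (1 : Fin (2 * m + 1) → ℝ) ᵥ* (colOne A j)⁻¹ - kernelVec A with hz
  obtain ⟨hj1, -⟩ := hardVec_abs_bounds hm hr j
  have hzj : |(z ᵥ* A) j| ≤ 6 / |r| := by
    -- `zᵀ A` is orthogonal to the kernel vector and equals 1 off `j`, so the sum of `(1 - zᵀ A)_k
    -- x_k` reduces to its `j`-th term.
    have h3 : (1 - (z ᵥ* A) j) * hardVec m r j = X := by
      have h4 : ∑ k, (1 - (z ᵥ* A) k) * hardVec m r k = X := by
        simp only [sub_mul, one_mul, Finset.sum_sub_distrib, hA.sum_vecMul_mul z, sub_zero, hX]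
      rwa [Finset.sum_eq_single j (fun k _ hk => by rw [h1 k hk, sub_self, zero_mul])
        (by simp)] at h4
    have h5 : |1 - (z ᵥ* A) j| * |r| ≤ 5 := by
      calc |1 - (z ᵥ* A) j| * |r| ≤ |1 - (z ᵥ* A) j| * |hardVec m r j| := by gcongr
        _ = X := by rw [← abs_mul, h3, abs_of_nonneg (by linarith)]
        _ ≤ 5 := hX2
    have h6 : |(z ᵥ* A) j| ≤ 1 + |1 - (z ᵥ* A) j| := by
      have := abs_sub_abs_le_abs_sub ((z ᵥ* A) j) 1
      rw [abs_one, abs_sub_comm] at this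
      linarith
    rw [le_div_iff₀ hrpos]
    nlinarith
  have hB : ∀ k, |(z ᵥ* A) k| ≤ 6 / |r| := by
    intro k
    rcases eq_or_ne k j with rfl | hk
    · exact hzj
    · rw [h1 k hk, abs_one, le_div_iff₀ hrpos]; linarith
  set w := z - z 0 • hardVec m r with hw
  have hwA : w ᵥ* A = z ᵥ* A := by
    rw [hw, Matrix.sub_vecMul, Matrix.smul_vecMul, hA.vecMul_eq, smul_zero, sub_zero]
  set W := 6 * K / (κ * |r|) with hW
  have hW0 : 0 < W := by positivity
  have hwi : ∀ i, |w i| ≤ W := by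
    intro i
    have h3 := hK κ hκ (κ * r) w (by simp [hw, hardVec_zero hm]) (6 / |r|) (by positivity)
      (fun k _ => by rw [← hAdef, hwA]; exact hB k) i
    rw [hW, le_div_iff₀ (by positivity)]
    calc |w i| * (κ * |r|) = κ * |w i| * |r| := by ring
      _ ≤ K * (6 / |r|) * |r| := by gcongr
      _ = 6 * K := by field_simp
  have hz0 : |z 0| * 3 ≤ (2 * m + 1) * W := by
    have h3 : ∑ i, w i = -(z 0 * X) := by
      simp only [hw, Pi.sub_apply, Pi.smul_apply, smul_eq_mul, Finset.sum_sub_distrib, h2,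
        ← Finset.mul_sum, hX, zero_sub]
    calc |z 0| * 3 ≤ |z 0| * X := by gcongr
      _ = |∑ i, w i| := by rw [h3, abs_neg, abs_mul, abs_of_nonneg (show 0 ≤ X by linarith)]
      _ ≤ ∑ i, |w i| := Finset.abs_sum_le_sum_abs _ _
      _ ≤ ∑ _i : Fin (2 * m + 1), W := Finset.sum_le_sum fun i _ => hwi i
      _ = (2 * m + 1) * W := by simp
  have hzi : z i = w i + z 0 * hardVec m r i := by simp [hw]
  calc |z i| ≤ |w i| + |z 0| * |hardVec m r i| := by
        rw [hzi, ← abs_mul]; exact abs_add_le _ _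
    _ ≤ W + |z 0| * 3 := by
        gcongr
        · exact hwi i
        · exact (hardVec_abs_bounds hm hr i).2
    _ ≤ W + (2 * m + 1) * W := by gcongr
    _ = 6 * K * (2 * m + 2) / (κ * |r|) := by rw [hW]; ring

/-! ## Redundancy of the hard games -/

/-- The normalised kernel vector is an equilibrium. Its smallest entry before normalisation is `r`,
and its sum is `4 + (2m - 3) r`, which is what the condition on `α` compares. -/
theorem not_alphaRedundant_hardGame {m : ℕ} (hm : 2 ≤ m) {κ r α : ℝ} (hr0 : 0 < r)
    (hr : |r| * (2 * m + 1) ≤ 1) (hα : α * (4 + (2 * m - 3) * r) ≤ r) :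
    ¬ AlphaRedundant α (hardGame (2 * m + 1) κ (κ * r)) := by
  rw [AlphaRedundant, not_not]
  have hX := (sum_hardVec_bounds hm hr).1
  have hr1 := (abs_le.1 (perturbation_bounds hm hr).1).2
  have hge : ∀ i, r ≤ hardVec m r i := by
    intro i
    rcases hardKernel_cases hm r i with hi | hi | hi <;> rw [hardVec, hi] <;> linarith
  set X := ∑ i, hardVec m r i with hXdef
  have hX0 : 0 < X := by linarith
  refine ⟨X⁻¹ • hardVec m r, ⟨⟨fun i => ?_, ?_⟩, fun y _ => ?_⟩, fun i => ?_⟩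
  · exact mul_nonneg (inv_pos.2 hX0).le (hr0.le.trans (hge i))
  · simp only [Pi.smul_apply, smul_eq_mul, ← Finset.mul_sum]
    exact inv_mul_cancel₀ hX0.ne'
  · rw [Matrix.dotProduct_mulVec, Matrix.smul_vecMul, hardVec_vecMul hm κ hr]
    simp
  · rw [Pi.smul_apply, smul_eq_mul, ← div_eq_inv_mul, le_div_iff₀ hX0, hXdef, sum_hardVec]
    exact hα.trans (hge i)

/-- An equilibrium exists; were it strictly positive, it would be a multiple of `hardVec`, whose
entries 0 and 1 are `1` and `r < 0`. -/
theorem not_nonRedundant_hardGame {m : ℕ} (hm : 2 ≤ m) {κ r : ℝ} (hκ : 0 < κ) (hr0 : r < 0)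
    (hr : |r| * (2 * m + 1) ≤ 1) : ¬ NonRedundant (hardGame (2 * m + 1) κ (κ * r)) := by
  intro h
  have hskew := hardGame_skew (2 * m + 1) κ (κ * r)
  obtain ⟨p, hp⟩ := exists_isNash hskew
  have hpos := h p hp
  obtain ⟨c, rfl⟩ := (kernelSpannedBy_hardGame hm hκ hr).span p (hp.vecMul_eq_zero hskew hpos)
  have h0 := hpos 0
  have h1 := hpos ⟨1, by omega⟩
  rw [Pi.smul_apply, smul_eq_mul, hardVec_zero hm, mul_one] at h0
  rw [Pi.smul_apply, smul_eq_mul, hardVec,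
    hardKernel_of_ne r one_ne_zero (show 1 ≠ m by omega) (show 1 ≠ 2 * m by omega)] at h1
  nlinarith

/-! ### Telling the games for `r` and `-r` apart. -/

theorem sum_sq_sub_hardGame {m : ℕ} (κ s t : ℝ) :
    ∑ p : Pair (2 * m + 1), (hardGame (2 * m + 1) κ s p.1.1 p.1.2
      - hardGame (2 * m + 1) κ t p.1.1 p.1.2) ^ 2 ≤ (s - t) ^ 2 := by
  rcases Nat.eq_zero_or_pos m with rfl | hm
  · rw [Finset.sum_eq_zero fun p _ => ?_]
    · positivity
    · exact absurd p.2 (by omega)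
  have hlt : (⟨0, by omega⟩ : Fin (2 * m + 1)) < ⟨2 * m, by omega⟩ := by
    rw [Fin.lt_def]; simp only; omega
  have heq : ∀ p : Pair (2 * m + 1), p ≠ ⟨(⟨0, by omega⟩, ⟨2 * m, by omega⟩), hlt⟩ →
      hardGame (2 * m + 1) κ s p.1.1 p.1.2 = hardGame (2 * m + 1) κ t p.1.1 p.1.2 := by
    rintro ⟨⟨i, j⟩, hij⟩ hne
    simp only [hardGame, if_pos hij, hardEntry]
    have : ¬ (i.val = 0 ∧ j.val = 2 * m) := fun ⟨h1, h2⟩ => hne (by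
      simp only [Subtype.mk.injEq, Prod.mk.injEq]
      exact ⟨Fin.ext h1, Fin.ext h2⟩)
    have hi := i.2
    have hj := j.2
    have hd : j.val - i.val ≤ 2 * m + 1 - 2 := by omega
    rw [if_pos hd, if_pos hd]
  rw [Finset.sum_eq_single ⟨(⟨0, by omega⟩, ⟨2 * m, by omega⟩), hlt⟩
    (fun p _ hp => by rw [heq p hp, sub_self]; simp) (by simp)]
  simp only [hardGame, if_pos hlt, hardEntry]
  split_ifs
  · simpa using sq_nonneg (s - t)
  · simpa using sq_nonneg (s - t)
  · exact le_of_eq (by ring)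

theorem verdict_hardGame {m : ℕ} (hm : 2 ≤ m) {κ r α : ℝ} (hκ : 0 < κ) (hr0 : 0 < r)
    (hr : |r| * (2 * m + 1) ≤ 1) (hα : α * (4 + (2 * m - 3) * r) ≤ r) (v : Verdict)
    (hv : v.Correct α (hardGame (2 * m + 1) κ (κ * r))) :
    ¬ v.Correct α (hardGame (2 * m + 1) κ (κ * -r)) := by
  cases v with
  | nonRedundant =>
    exact not_nonRedundant_hardGame hm hκ (neg_lt_zero.2 hr0) (by rwa [abs_neg])
  | alphaRedundant => exact absurd hv (not_alphaRedundant_hardGame hm hr0 hr hα)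

/-- The games are at squared distance at most `(2 κ r)²`, whence `3200 = 4 · 800`. Incompatibility
of verdicts is symmetric, so both games are hard. -/
theorem needsRounds_hardGame {m : ℕ} (hm : 2 ≤ m) {κ r α δ : ℝ} (hκ : 0 < κ) (hκ' : κ ≤ 1 / 4)
    (hr0 : 0 < r) (hr : r * (2 * m + 1) ≤ 1) (hα : α * (4 + (2 * m - 3) * r) ≤ r) (hδ0 : 0 < δ)
    (hδ : δ < 1 / 3) {𝒜 : Algorithm.{u} (2 * m + 1)} (h𝒜 : 𝒜.IsPAC α δ) :
    𝒜.NeedsRounds (hardGame (2 * m + 1) κ (κ * r))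
        (1 / (3200 * (κ * r) ^ 2) * Real.log (1 / δ)) ∧
      𝒜.NeedsRounds (hardGame (2 * m + 1) κ (κ * -r))
        (1 / (3200 * (κ * r) ^ 2) * Real.log (1 / δ)) := by
  have hr' : |r| * (2 * m + 1) ≤ 1 := by rwa [abs_of_pos hr0]
  have hr'' : |-r| * (2 * m + 1) ≤ 1 := by rwa [abs_neg]
  have hD : (0 : ℝ) < 4 * (κ * r) ^ 2 := by positivity
  have hconst : (3200 : ℝ) * (κ * r) ^ 2 = 800 * (4 * (κ * r) ^ 2) := by ring
  have hv := verdict_hardGame hm hκ hr0 hr' hα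
  rw [hconst]
  constructor
  · exact h𝒜.needsRounds hδ0 hδ (isAdmissible_hardGame hm hκ hκ' hr')
      (isAdmissible_hardGame hm hκ hκ' hr'') hv (fun p => abs_hardGame_le hm hκ hκ' hr' _ _)
      (fun p => abs_hardGame_le hm hκ hκ' hr'' _ _) hD
      ((sum_sq_sub_hardGame _ _ _).trans (le_of_eq (by ring)))
  · exact h𝒜.needsRounds hδ0 hδ (isAdmissible_hardGame hm hκ hκ' hr'')
      (isAdmissible_hardGame hm hκ hκ' hr') (fun v h h' => hv v h' h)
      (fun p => abs_hardGame_le hm hκ hκ' hr'' _ _)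
      (fun p => abs_hardGame_le hm hκ hκ' hr' _ _) hD
      ((sum_sq_sub_hardGame _ _ _).trans (le_of_eq (by ring)))

theorem Algorithm.NeedsRounds.mono {n : ℕ} {𝒜 : Algorithm.{u} n} {A : Matrix (Fin n) (Fin n) ℝ}
    {b b' : ℝ} (h : 𝒜.NeedsRounds A b) (hb : b' ≤ b) : 𝒜.NeedsRounds A b' := by
  obtain ⟨ν, hν, h⟩ := h
  exact ⟨ν, hν, (ENNReal.ofReal_le_ofReal hb).trans h⟩

end DuelingGame

/-! ### The lower bounds: choice of `r` and `κ`. -/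

theorem theorem5 (n : ℕ) (hn_odd : Odd n) (hn_lower : 5 ≤ n) (hn_upper : n ≤ 19) :
    ∃ c > (0 : ℝ), ∃ Φ₀ > (0 : ℝ),
      ∀ α δ : ℝ, 0 < α → α ≤ 1 / (5 * n) → 0 < δ → δ < 1 / 3 →
      ∀ 𝒜 : DuelingGame.Algorithm.{u} n, 𝒜.IsPAC α δ →
        (∀ Φ : ℝ, Φ₀ ≤ Φ → ∃ A : Matrix (Fin n) (Fin n) ℝ,
          DuelingGame.IsAdmissible A ∧ DuelingGame.phi A = Φ ∧
          𝒜.NeedsRounds A (c * DuelingGame.phi A ^ 2 * Real.log (1 / δ))) ∧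
        (∀ κ : ℝ, n * α ≤ κ → 4 * κ + (n - 4) * α ≤ 1 →
          ∀ A ∈ ({DuelingGame.hardGame n κ α, DuelingGame.hardGame n κ (-α)} :
              Set (Matrix (Fin n) (Fin n) ℝ)),
            DuelingGame.IsAdmissible A ∧
            𝒜.NeedsRounds A
              (c * max (1 / α ^ 2) (DuelingGame.phi A ^ 2) * Real.log (1 / δ))) := by
  open DuelingGame in
  obtain ⟨m, rfl⟩ := hn_odd
  have hm : 2 ≤ m := by omega
  have hm' : (2 : ℝ) ≤ m := by exact_mod_cast hm
  obtain ⟨C, hC0, hC⟩ := exists_phi_hardGame_le hm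
  push_cast
  -- The largest `r` with `r n ≤ 1`; then `4 + (n - 4) r₀ ≤ 5`, so `α ≤ 1/(5n) = r₀/5` suffices for
  -- the redundancy condition.
  set r₀ : ℝ := 1 / (2 * m + 1) with hr₀
  have hr₀pos : 0 < r₀ := by positivity
  have hr₀n : r₀ * (2 * m + 1) = 1 := by rw [hr₀]; field_simp
  have hr₀' : |r₀| * (2 * m + 1) ≤ 1 := by rw [abs_of_pos hr₀pos, hr₀n]
  set φ₀ := phi (hardGame (2 * m + 1) 1 r₀) with hφ₀
  have hφ₀pos : 0 < φ₀ := phi_hardGame_one_pos hm hr₀' hr₀pos.ne'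
  -- The two terms of the minimum serve the two claims; the threshold `4 φ₀` ensures `κ = φ₀ / Φ ≤
  -- 1/4`.
  refine ⟨min (1 / (3200 * (φ₀ * r₀) ^ 2)) (1 / (3200 * (1 + C ^ 2))), by positivity, 4 * φ₀,
    by positivity, fun α δ hα0 hα hδ0 hδ 𝒜 h𝒜 => ?_⟩
  set c := min (1 / (3200 * (φ₀ * r₀) ^ 2)) (1 / (3200 * (1 + C ^ 2))) with hc
  have hlog : 0 ≤ Real.log (1 / δ) := Real.log_nonneg (by rw [le_div_iff₀ hδ0]; linarith)
  constructor
  · intro Φ hΦ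
    have hΦ0 : 0 < Φ := by linarith
    set κ := φ₀ / Φ with hκdef
    have hκ : 0 < κ := by positivity
    have hκ' : κ ≤ 1 / 4 := by rw [hκdef, div_le_iff₀ hΦ0]; linarith
    have hphi : phi (hardGame (2 * m + 1) κ (κ * r₀)) = Φ := by
      rw [phi_hardGame hm hκ hr₀' hr₀pos.ne', ← hφ₀, hκdef]; field_simp
    have hαr : α * (4 + (2 * m - 3) * r₀) ≤ r₀ := by
      have h1 : (2 * m - 3) * r₀ ≤ 1 := by rw [← hr₀n]; nlinarith
      have h2 : α ≤ r₀ / 5 := hα.trans (le_of_eq (by rw [hr₀]; field_simp))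
      nlinarith
    refine ⟨_, isAdmissible_hardGame hm hκ hκ' hr₀', hphi,
      (needsRounds_hardGame hm hκ hκ' hr₀pos hr₀n.le hαr hδ0 hδ h𝒜).1.mono ?_⟩
    rw [hphi]
    refine mul_le_mul_of_nonneg_right ?_ hlog
    calc c * Φ ^ 2 ≤ 1 / (3200 * (φ₀ * r₀) ^ 2) * Φ ^ 2 := by
          gcongr; exact min_le_left _ _
      _ = 1 / (3200 * (κ * r₀) ^ 2) := by rw [hκdef]; field_simp
  · intro κ hκα hκα' A hA
    have hκ : 0 < κ := lt_of_lt_of_le (by positivity) hκα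
    have hκ' : κ ≤ 1 / 4 := by nlinarith
    set r := α / κ with hr
    have hr0 : 0 < r := by positivity
    have hκr : κ * r = α := by rw [hr]; field_simp
    have hr1 : r * (2 * m + 1) ≤ 1 := by
      rw [hr, div_mul_eq_mul_div, div_le_one hκ]; linarith
    have hr' : |r| * (2 * m + 1) ≤ 1 := by rwa [abs_of_pos hr0]
    have hr'' : |-r| * (2 * m + 1) ≤ 1 := by rwa [abs_neg]
    -- Multiplied by `κ`, this is `α` times the hypothesis `4 κ + (n - 4) α ≤ 1`.
    have hαr : α * (4 + (2 * m - 3) * r) ≤ r := by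
      refine le_of_mul_le_mul_left ?_ hκ
      have : κ * (α * (4 + (2 * m - 3) * r)) = α * (4 * κ + (2 * m + 1 - 4) * α) := by
        rw [← hκr]; ring
      rw [this, hκr]
      exact mul_le_of_le_one_right hα0.le hκα'
    have hneeds := needsRounds_hardGame hm hκ hκ' hr0 hr1 hαr hδ0 hδ h𝒜
    have hbound : ∀ B : Matrix (Fin (2 * m + 1)) (Fin (2 * m + 1)) ℝ, phi B ≤ C / α →
        c * max (1 / α ^ 2) (phi B ^ 2) * Real.log (1 / δ)
          ≤ 1 / (3200 * (κ * r) ^ 2) * Real.log (1 / δ) := by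
      intro B hB
      refine mul_le_mul_of_nonneg_right ?_ hlog
      -- Since `κ |r| = α`, the bound on `φ` reads `C / α`, so both terms of the maximum are of
      -- order `1 / α²`.
      have h1 : max (1 / α ^ 2) (phi B ^ 2) ≤ (1 + C ^ 2) / α ^ 2 := by
        refine max_le (by gcongr; nlinarith) ?_
        calc phi B ^ 2 ≤ (C / α) ^ 2 := by gcongr; exact phi_nonneg B
          _ = C ^ 2 / α ^ 2 := by rw [div_pow]
          _ ≤ _ := by gcongr; linarith
      calc c * max (1 / α ^ 2) (phi B ^ 2)
          ≤ 1 / (3200 * (1 + C ^ 2)) * ((1 + C ^ 2) / α ^ 2) := by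
            gcongr
            exact min_le_right _ _
        _ = 1 / (3200 * (κ * r) ^ 2) := by rw [hκr]; field_simp
    have hneg : κ * -r = -α := by rw [mul_neg, hκr]
    rcases hA with rfl | rfl
    · have hphi := hC κ hκ r hr' hr0.ne'
      have hadm := isAdmissible_hardGame hm hκ hκ' hr'
      rw [abs_of_pos hr0] at hphi
      rw [hκr] at hphi hadm
      have hneeds' := hneeds.1
      rw [show hardGame (2 * m + 1) κ (κ * r) = hardGame (2 * m + 1) κ α by rw [hκr]] at hneeds'
      exact ⟨hadm, hneeds'.mono (hbound _ hphi)⟩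
    · have hphi := hC κ hκ (-r) hr'' (neg_ne_zero.2 hr0.ne')
      have hadm := isAdmissible_hardGame hm hκ hκ' hr''
      rw [abs_neg, abs_of_pos hr0, hκr, hneg] at hphi
      rw [hneg] at hadm hneeds
      exact ⟨hadm, hneeds.2.mono (hbound _ hphi)⟩
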